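/- Theorem (outer loop of the receding-horizon policy gradient method). Let $n,m\ge 1$, let $A\in\mathbb R^{n\times n}$ be invertible, $B\in\mathbb R^{n\times m}$ with $(A,B)$ stabilizable, and let $Q\in\mathbb R^{n\times n}$, $R\in\mathbb R^{m\times m}$ be symmetric positive definite. Let the initial state $x_0$ be a random vector with law $\mathcal D$ on $\mathbb R^n$ such that $\mathbb E[x_0]=0$, $\mathbb E[x_0x_0^\top]=\Sigma_0\succ 0$ and $x_0^\top x_0\le C_m$ almost surely, where $C_m>0$. Notation. $\|X\|$ is the spectral norm, $\kappa_X=\|X\|\,\|X^{-1}\|$, $\lambda_{\min}$ and $\sigma_{\min}$ are the smallest eigenvalue and smallest singular value. Let $P^*$ be the positive definite solution of $$P=A^\top PA-A^\top PB(R+B^\top PB)^{-1}B^\top PA+Q,$$ and put $K^*=(R+B^\top P^*B)^{-1}B^\top P^*A$, $A_K^*=A-BK^*$ and $\|X\|_*^2=\sup_{z\ne0}\frac{z^\top X^\top P^*Xz}{z^\top P^*z}$. A gain $K\in\mathbb R^{m\times n}$ is called stabilizing if the spectral radius of $A-BK$ is less than $1$. Let $Q_N$ be symmetric with $Q_N\succeq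 P^*$, let $\varepsilon>0$, and let $N\ge1$ be an integer with $$N\ \ge\ \frac12\cdot\frac{\log\left(\frac{2\|Q_N-P^*\|_*\,\kappa_{P^*}\,\|A_K^*\|\,\|B\|}{\varepsilon\,\lambda_{\min}(R)}\right)}{\log\left(\frac1{\|A_K^*\|_*}\right)}+1$$ (this is no restriction beyond $N\ge 1$ if the argument of the logarithm in the numerator is $0$). Let $P_N^*=Q_N$ and, for $h=N-1,\dots,0$, let $K_h^*=(R+B^\top P_{h+1}^*B)^{-1}B^\top P_{h+1}^*A$ and $P_h^*=(A-BK_h^*)^\top P_{h+1}^*(A-BK_h^*)+(K_h^*)^\top RK_h^*+Q$. Define $$a=\frac{\sigma_{\min}(Q)}2,\qquad \varphi=\max_{0\le t\le N-1}\|A-BK_t^*\|,\qquad C_1=\frac{\varphi\|B\|}{\lambda_{\min}(R)},\qquad C_3=2\|R+B^\top(Q_N+aI)B\|,$$ $\varsigma_{0,\varepsilon}=\varepsilon/4$ and, for $h\ge1$, $$\varsigma_{h,\varepsilon}=\min\left\{\sqrt{\frac a{C_3}\frac1N},\ \sqrt{\frac a{C_3}\frac a{2eN\|Q_N\|}},\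 \sqrt{\frac a{C_3}\frac{\varepsilon}{8eNC_1\|Q_N\|}},\ \sqrt{\frac{\varepsilon}{4C_1C_3}}\right\}$$ (if $C_1=0$, the last two terms are read as $+\infty$). Let $\widetilde K_{N-1},\dots,\widetilde K_0\in\mathbb R^{m\times n}$ be gains. For $0\le h\le N-1$ and $K\in\mathbb R^{m\times n}$ let $$\widetilde J_h(K)=\mathbb E\left[x_0^\top(Q+K^\top RK)x_0+\sum_{t=h+1}^{N-1}x_{t-h}^\top(Q+\widetilde K_t^\top R\widetilde K_t)x_{t-h}+x_{N-h}^\top Q_Nx_{N-h}\right],$$ where $x_1=(A-BK)x_0$ and $x_{t-h+1}=(A-B\widetilde K_t)x_{t-h}$ for $h<t<N$, and let $\widetilde K_h^*$ be a minimizer of $\widetilde J_h$. Suppose that $$\|\widetilde K_h-\widetilde K_h^*\|\le\varsigma_{h,\varepsilon}\qquad\text{for all }h\in\{0,\dots,N-1\}.$$ Then $\|\widetilde K_0-K^*\|\le\varepsilon$. Moreover, if $\varepsilon\,\kappa_{P^*}^{1/2}\|B\|<1-\|A-BK^*\|_*$, that is, $\varepsilon<\frac{1-\|A-BK^*\|_*}{\kappa_{P^*}^{1/2}\|B\|}$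 when $B\ne0$, then $\widetilde K_0$ is stabilizing. -/

import Mathlib

open MeasureTheory
open scoped Matrix
-- `‖X‖` on real matrices is the spectral norm (the operator norm for the Euclidean norms).
open scoped Matrix.Norms.L2Operator

namespace LQR

noncomputable section

/-- Smallest eigenvalue of a symmetric real matrix. -/
def lambdaMin {k : ℕ} (X : Matrix (Fin k) (Fin k) ℝ) : ℝ :=
  sInf (spectrum ℝ X)

/-- Smallest singular value of a square real matrix. -/
def sigmaMin {k : ℕ} (X : Matrix (Fin k) (Fin k) ℝ) : ℝ :=
  Real.sqrt (lambdaMin (Xᵀ * X))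

/-- Condition number with respect to the spectral norm. -/
def condNumber {k : ℕ} (X : Matrix (Fin k) (Fin k) ℝ) : ℝ :=
  ‖X‖ * ‖X⁻¹‖

/-- The `W`-induced norm: `‖X‖_W² = sup_{z ≠ 0} (zᵀ Xᵀ W X z) / (zᵀ W z)`. -/
def inducedNorm {k : ℕ} (W X : Matrix (Fin k) (Fin k) ℝ) : ℝ :=
  Real.sqrt (⨆ z : {z : Fin k → ℝ // z ≠ 0},
    (z.1 ⬝ᵥ ((Xᵀ * W * X) *ᵥ z.1)) / (z.1 ⬝ᵥ (W *ᵥ z.1)))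

/-- A square real matrix is (Schur) stable if its complex spectral radius is less than one. -/
def IsStable {k : ℕ} (X : Matrix (Fin k) (Fin k) ℝ) : Prop :=
  spectralRadius ℂ (X.map (algebraMap ℝ ℂ)) < 1

variable {n m : ℕ}

/-- The policy `u = -K x` is stabilizing for `x⁺ = A x + B u`. -/
def IsStabilizing (A : Matrix (Fin n) (Fin n) ℝ) (B : Matrix (Fin n) (Fin m) ℝ)
    (K : Matrix (Fin m) (Fin n) ℝ) : Prop :=
  IsStable (A - B * K)

/-- The pair `(A, B)` is stabilizable. -/
def IsStabilizable (A : Matrix (Fin n) (Fin n) ℝ) (B : Matrix (Fin n) (Fin m) ℝ) : Prop :=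
  ∃ K : Matrix (Fin m) (Fin n) ℝ, IsStabilizing A B K

/-- The law `D` of the initial state: centred, with second-moment matrix `S₀`, and almost surely
of squared Euclidean norm at most `Cm`. -/
structure IsInitialLaw (D : Measure (Fin n → ℝ)) (S₀ : Matrix (Fin n) (Fin n) ℝ) (Cm : ℝ) :
    Prop where
  isProbabilityMeasure : IsProbabilityMeasure D
  mean_zero : ∀ i, ∫ x, x i ∂D = 0
  second_moment : ∀ i j, ∫ x, x i * x j ∂D = S₀ i j
  bounded : ∀ᵐ x ∂D, x ⬝ᵥ x ≤ Cm

/-- The gain `(R + Bᵀ P B)⁻¹ Bᵀ P A`. -/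
def gain (A : Matrix (Fin n) (Fin n) ℝ) (B : Matrix (Fin n) (Fin m) ℝ)
    (R : Matrix (Fin m) (Fin m) ℝ) (P : Matrix (Fin n) (Fin n) ℝ) : Matrix (Fin m) (Fin n) ℝ :=
  (R + Bᵀ * P * B)⁻¹ * Bᵀ * P * A

/-- `P` is a positive definite solution of the discrete-time algebraic Riccati equation. -/
def IsRiccatiSolution (A : Matrix (Fin n) (Fin n) ℝ) (B : Matrix (Fin n) (Fin m) ℝ)
    (Q : Matrix (Fin n) (Fin n) ℝ) (R : Matrix (Fin m) (Fin m) ℝ)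
    (P : Matrix (Fin n) (Fin n) ℝ) : Prop :=
  P.PosDef ∧ P = Aᵀ * P * A - Aᵀ * P * B * (R + Bᵀ * P * B)⁻¹ * Bᵀ * P * A + Q

/-- The Riccati difference equation started at `QN`, indexed by the number of remaining steps. -/
def rde (A : Matrix (Fin n) (Fin n) ℝ) (B : Matrix (Fin n) (Fin m) ℝ)
    (Q : Matrix (Fin n) (Fin n) ℝ) (R : Matrix (Fin m) (Fin m) ℝ)
    (QN : Matrix (Fin n) (Fin n) ℝ) : ℕ → Matrix (Fin n) (Fin n) ℝ
  | 0 => QN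
  | k + 1 =>
    (A - B * gain A B R (rde A B Q R QN k))ᵀ * rde A B Q R QN k *
        (A - B * gain A B R (rde A B Q R QN k))
      + (gain A B R (rde A B Q R QN k))ᵀ * R * gain A B R (rde A B Q R QN k) + Q

/-- `P*_t`, the solution of the Riccati difference equation with `P*_N = QN`, for `t ≤ N`. -/
def rdeP (A : Matrix (Fin n) (Fin n) ℝ) (B : Matrix (Fin n) (Fin m) ℝ)
    (Q : Matrix (Fin n) (Fin n) ℝ) (R : Matrix (Fin m) (Fin m) ℝ)
    (QN : Matrix (Fin n) (Fin n) ℝ) (N t : ℕ) : Matrix (Fin n) (Fin n) ℝ :=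
  rde A B Q R QN (N - t)

/-- `K*_t = (R + Bᵀ P*_{t+1} B)⁻¹ Bᵀ P*_{t+1} A`, for `t < N`. -/
def rdeK (A : Matrix (Fin n) (Fin n) ℝ) (B : Matrix (Fin n) (Fin m) ℝ)
    (Q : Matrix (Fin n) (Fin n) ℝ) (R : Matrix (Fin m) (Fin m) ℝ)
    (QN : Matrix (Fin n) (Fin n) ℝ) (N t : ℕ) : Matrix (Fin m) (Fin n) ℝ :=
  gain A B R (rdeP A B Q R QN N (t + 1))

/-- The state after `i` steps from `x₀`, when `K` is applied at the first step (time `h`) and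
`Kt (h + j)` is applied at each later step `j ≥ 1` (time `h + j`). -/
def state (A : Matrix (Fin n) (Fin n) ℝ) (B : Matrix (Fin n) (Fin m) ℝ)
    (Kt : ℕ → Matrix (Fin m) (Fin n) ℝ) (h : ℕ) (K : Matrix (Fin m) (Fin n) ℝ)
    (x₀ : Fin n → ℝ) : ℕ → Fin n → ℝ
  | 0 => x₀
  | 1 => (A - B * K) *ᵥ x₀
  | j + 2 => (A - B * Kt (h + (j + 1))) *ᵥ state A B Kt h K x₀ (j + 1)

/-- The surrogate cost from time `h` to the horizon `N`, as a function of the gain `K` used at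
time `h`, with the gains `Kt t` frozen for `h < t < N`. -/
def surrogateCost (A : Matrix (Fin n) (Fin n) ℝ) (B : Matrix (Fin n) (Fin m) ℝ)
    (Q : Matrix (Fin n) (Fin n) ℝ) (R : Matrix (Fin m) (Fin m) ℝ)
    (QN : Matrix (Fin n) (Fin n) ℝ) (D : Measure (Fin n → ℝ)) (N : ℕ)
    (Kt : ℕ → Matrix (Fin m) (Fin n) ℝ) (h : ℕ) (K : Matrix (Fin m) (Fin n) ℝ) : ℝ :=
  ∫ x₀, ((∑ t ∈ Finset.Ico (h + 1) N,
        state A B Kt h K x₀ (t - h) ⬝ᵥ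
          ((Q + (Kt t)ᵀ * R * Kt t) *ᵥ state A B Kt h K x₀ (t - h)))
      + x₀ ⬝ᵥ ((Q + Kᵀ * R * K) *ᵥ x₀)
      + state A B Kt h K x₀ (N - h) ⬝ᵥ (QN *ᵥ state A B Kt h K x₀ (N - h))) ∂D

/-- The lower bound on the horizon, with `P` the solution of the algebraic Riccati equation. -/
def horizonBound (A : Matrix (Fin n) (Fin n) ℝ) (B : Matrix (Fin n) (Fin m) ℝ)
    (R : Matrix (Fin m) (Fin m) ℝ) (QN P : Matrix (Fin n) (Fin n) ℝ) (ε : ℝ) : ℝ :=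
  1 / 2 *
      (Real.log (2 * inducedNorm P (QN - P) * condNumber P * ‖A - B * gain A B R P‖ * ‖B‖
          / (ε * lambdaMin R))
        / Real.log (1 / inducedNorm P (A - B * gain A B R P))) + 1

/-- `a = σ_min(Q) / 2`. -/
def constA (Q : Matrix (Fin n) (Fin n) ℝ) : ℝ := sigmaMin Q / 2

/-- `φ = max_{0 ≤ t ≤ N-1} ‖A - B K*_t‖`. -/
def constPhi (A : Matrix (Fin n) (Fin n) ℝ) (B : Matrix (Fin n) (Fin m) ℝ)
    (Q : Matrix (Fin n) (Fin n) ℝ) (R : Matrix (Fin m) (Fin m) ℝ)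
    (QN : Matrix (Fin n) (Fin n) ℝ) (N : ℕ) : ℝ :=
  ⨆ t : Fin N, ‖A - B * rdeK A B Q R QN N t‖

/-- `C₁ = φ ‖B‖ / λ_min(R)`. -/
def constC1 (A : Matrix (Fin n) (Fin n) ℝ) (B : Matrix (Fin n) (Fin m) ℝ)
    (Q : Matrix (Fin n) (Fin n) ℝ) (R : Matrix (Fin m) (Fin m) ℝ)
    (QN : Matrix (Fin n) (Fin n) ℝ) (N : ℕ) : ℝ :=
  constPhi A B Q R QN N * ‖B‖ / lambdaMin R

/-- `C₃ = 2 ‖R + Bᵀ (QN + a I) B‖`. -/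
def constC3 (B : Matrix (Fin n) (Fin m) ℝ) (Q : Matrix (Fin n) (Fin n) ℝ)
    (R : Matrix (Fin m) (Fin m) ℝ) (QN : Matrix (Fin n) (Fin n) ℝ) : ℝ :=
  2 * ‖R + Bᵀ * (QN + constA Q • (1 : Matrix (Fin n) (Fin n) ℝ)) * B‖

/-- The tolerance at stage `h`. For `h ≥ 1` it is the minimum of four terms, two of which have
`C₁` in the denominator; these two are read as `+∞` (that is, dropped) when `C₁ = 0`. -/
def tolerance (A : Matrix (Fin n) (Fin n) ℝ) (B : Matrix (Fin n) (Fin m) ℝ)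
    (Q : Matrix (Fin n) (Fin n) ℝ) (R : Matrix (Fin m) (Fin m) ℝ)
    (QN : Matrix (Fin n) (Fin n) ℝ) (N : ℕ) (ε : ℝ) (h : ℕ) : ℝ :=
  let a := constA Q
  let C1 := constC1 A B Q R QN N
  let C3 := constC3 B Q R QN
  let t1 := Real.sqrt (a / C3 * (1 / N))
  let t2 := Real.sqrt (a / C3 * (a / (2 * Real.exp 1 * N * ‖QN‖)))
  let t3 := Real.sqrt (a / C3 * (ε / (8 * Real.exp 1 * N * C1 * ‖QN‖)))
  let t4 := Real.sqrt (ε / (4 * C1 * C3))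
  open Classical in
  if h = 0 then ε / 4
  else if C1 = 0 then min t1 t2
  else min (min t1 t2) (min t3 t4)

end

end LQR

/-! ### Quadratic forms, the spectral norm and inverses. -/

namespace LQR

section Forms

variable {k l : ℕ}

/-! Write V_S(K) for `policyValue`, g_S for `gain`, M_S = R + BᵀSB, and ρ for the P-induced norm of
the optimal closed loop A - B g_P. Completing the square gives V_S(K) = V_S(g_S) + (K - g_S)ᵀ M_S (K
- g_S) (`policyValue_eq_add`). The surrogate cost is the expectation of the quadratic form of
V_S(K), with S the cost-to-go of the later gains. Since Σ₀ ≻ 0, its only minimizer is g_S, so the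
hypotheses bound K̃_h - g_S (`eq_gain_of_isMinOn`).

The error is measured by an s with S - P ⪯ sP. Because V_S(g_S) ⪯ V_S(g_P) and V_P(g_P) = P, a
backward step with gain error τ sends s to at most ρ²s + ‖M_S‖τ²/(2a), using P ⪰ 2aI
(`policyValue_step`). As ‖M_S‖ ≤ (C₃/2)(1 + s), this is the recursion s ↦ ρ²s + ν(1 + s) with ν =
C₃τ²/(4a). By `perturbed_recursion_bound`, N - 1 steps from δ = ‖P⁻¹‖‖QN - P‖ leave at most
(5/4)ρ^(2(N-1))δ + 2Nν.

`norm_gain_sub_gain_le` turns a cost error into a gain error with factor c = ‖B‖‖A - B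
g_P‖/λ_min(R). The horizon bound makes the first summand contribute at most 5ε/8
(`truncation_error_le`), the tolerances make the second contribute at most ε/8, and stage 0 adds its
own ε/4.

The delicate point is that C₁ contains φ, not ‖A - B g_P‖. In `closedLoop_mul_tolerance_le`, either
‖A - B g_P‖ ≤ 2φ and the third tolerance term suffices, or P₁* is still at distance at least a from
P. The horizon bound then forces ca ≤ ε/2, and the second term suffices. Stability follows from the
triangle inequality in the norm defined by P (`isStable_add`). -/

theorem dotProduct_self_eq_norm_sq (v : Fin k → ℝ) : v ⬝ᵥ v = ‖WithLp.toLp 2 v‖ ^ 2 := by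
  rw [EuclideanSpace.real_norm_sq_eq]
  simp [dotProduct, sq]

theorem dotProduct_sq_le (u v : Fin k → ℝ) : (u ⬝ᵥ v) ^ 2 ≤ (u ⬝ᵥ u) * (v ⬝ᵥ v) := by
  have h := Finset.sum_mul_sq_le_sq_mul_sq Finset.univ u v
  simpa [dotProduct, sq] using h

theorem dotProduct_self_nonneg' (v : Fin k → ℝ) : 0 ≤ v ⬝ᵥ v := by
  rw [dotProduct_self_eq_norm_sq]; positivity

theorem mulVec_dotProduct_self_le (X : Matrix (Fin l) (Fin k) ℝ) (v : Fin k → ℝ) :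
    (X *ᵥ v) ⬝ᵥ (X *ᵥ v) ≤ ‖X‖ ^ 2 * (v ⬝ᵥ v) := by
  rw [dotProduct_self_eq_norm_sq, dotProduct_self_eq_norm_sq, ← mul_pow]
  gcongr
  exact Matrix.l2_opNorm_mulVec X (WithLp.toLp 2 v)

theorem norm_le_of_mulVec {X : Matrix (Fin l) (Fin k) ℝ} {c : ℝ} (hc : 0 ≤ c)
    (h : ∀ v, (X *ᵥ v) ⬝ᵥ (X *ᵥ v) ≤ c ^ 2 * (v ⬝ᵥ v)) : ‖X‖ ≤ c := by
  rw [Matrix.l2_opNorm_def]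
  refine ContinuousLinearMap.opNorm_le_bound _ hc fun v => ?_
  have h1 := h (WithLp.ofLp v)
  rw [dotProduct_self_eq_norm_sq, dotProduct_self_eq_norm_sq, ← mul_pow] at h1
  exact (sq_le_sq₀ (norm_nonneg _) (by positivity)).1 h1

theorem norm_transpose (X : Matrix (Fin l) (Fin k) ℝ) : ‖Xᵀ‖ = ‖X‖ := by
  rw [← Matrix.conjTranspose_eq_transpose_of_trivial, Matrix.l2_opNorm_conjTranspose]

theorem abs_form_le (X : Matrix (Fin k) (Fin k) ℝ) (v : Fin k → ℝ) :
    |v ⬝ᵥ (X *ᵥ v)| ≤ ‖X‖ * (v ⬝ᵥ v) := by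
  have h1 := dotProduct_sq_le v (X *ᵥ v)
  have h2 := mulVec_dotProduct_self_le X v
  have h0 := dotProduct_self_nonneg' v
  refine abs_le_of_sq_le_sq ?_ (by positivity)
  calc _ ≤ _ := h1
    _ ≤ (v ⬝ᵥ v) * (‖X‖ ^ 2 * (v ⬝ᵥ v)) := by gcongr
    _ = _ := by ring

theorem form_le_norm (X : Matrix (Fin k) (Fin k) ℝ) (v : Fin k → ℝ) : v ⬝ᵥ (X *ᵥ v) ≤ ‖X‖ * (v ⬝ᵥ v) :=
  (le_abs_self _).trans (abs_form_le X v)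

theorem form_mulVec (X : Matrix (Fin l) (Fin l) ℝ) (F : Matrix (Fin l) (Fin k) ℝ) (v : Fin k → ℝ) :
    v ⬝ᵥ ((Fᵀ * X * F) *ᵥ v) = (F *ᵥ v) ⬝ᵥ (X *ᵥ (F *ᵥ v)) := by
  rw [← Matrix.mulVec_mulVec, ← Matrix.mulVec_mulVec, Matrix.dotProduct_mulVec,
    Matrix.vecMul_transpose]

theorem exists_transpose_mul_self {X : Matrix (Fin k) (Fin k) ℝ} (hX : X.PosSemidef) :
    ∃ L : Matrix (Fin k) (Fin k) ℝ, X = Lᵀ * L := by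
  open scoped MatrixOrder in
  obtain ⟨L, hL⟩ := CStarAlgebra.nonneg_iff_eq_star_mul_self.1 hX.nonneg
  exact ⟨L, by rw [hL, Matrix.star_eq_conjTranspose,
    Matrix.conjTranspose_eq_transpose_of_trivial]⟩

theorem form_transpose_mul_self (L : Matrix (Fin l) (Fin k) ℝ) (v : Fin k → ℝ) :
    v ⬝ᵥ ((Lᵀ * L) *ᵥ v) = (L *ᵥ v) ⬝ᵥ (L *ᵥ v) := by
  have := form_mulVec (1 : Matrix (Fin l) (Fin l) ℝ) L v
  simpa using this

theorem norm_transpose_mul_self (L : Matrix (Fin l) (Fin k) ℝ) : ‖Lᵀ * L‖ = ‖L‖ ^ 2 := by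
  rw [← Matrix.conjTranspose_eq_transpose_of_trivial, Matrix.l2_opNorm_conjTranspose_mul_self, sq]

theorem form_nonneg {X : Matrix (Fin k) (Fin k) ℝ} (hX : X.PosSemidef) (v : Fin k → ℝ) :
    0 ≤ v ⬝ᵥ (X *ᵥ v) := by
  simpa using hX.dotProduct_mulVec_nonneg v

theorem form_pos {X : Matrix (Fin k) (Fin k) ℝ} (hX : X.PosDef) {v : Fin k → ℝ} (hv : v ≠ 0) :
    0 < v ⬝ᵥ (X *ᵥ v) := by
  simpa using hX.dotProduct_mulVec_pos hv

theorem transpose_eq {X : Matrix (Fin k) (Fin k) ℝ} (hX : X.PosSemidef) : Xᵀ = X := by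
  rw [← Matrix.conjTranspose_eq_transpose_of_trivial]; exact hX.1

theorem posSemidef_of_form {X : Matrix (Fin k) (Fin k) ℝ} (hX : Xᵀ = X) (h : ∀ v, 0 ≤ v ⬝ᵥ (X *ᵥ v)) :
    X.PosSemidef :=
  .of_dotProduct_mulVec_nonneg
    (by rw [Matrix.IsHermitian, Matrix.conjTranspose_eq_transpose_of_trivial, hX])
    fun v => by simpa using h v

/-- A factorization X = LᵀL turns the form into |Lv|² and the norm into ‖L‖². -/
theorem norm_le_of_form {X : Matrix (Fin k) (Fin k) ℝ} (hX : X.PosSemidef) {c : ℝ} (hc : 0 ≤ c)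
    (h : ∀ v, v ⬝ᵥ (X *ᵥ v) ≤ c * (v ⬝ᵥ v)) : ‖X‖ ≤ c := by
  obtain ⟨L, rfl⟩ := exists_transpose_mul_self hX
  rw [norm_transpose_mul_self]
  have : ‖L‖ ≤ Real.sqrt c := by
    refine norm_le_of_mulVec (Real.sqrt_nonneg c) fun v => ?_
    rw [Real.sq_sqrt hc, ← form_transpose_mul_self]
    exact h v
  calc ‖L‖ ^ 2 ≤ (Real.sqrt c) ^ 2 := by gcongr
    _ = c := Real.sq_sqrt hc

theorem norm_mono {X Y : Matrix (Fin k) (Fin k) ℝ} (hX : X.PosSemidef)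
    (h : ∀ v, v ⬝ᵥ (X *ᵥ v) ≤ v ⬝ᵥ (Y *ᵥ v)) : ‖X‖ ≤ ‖Y‖ :=
  norm_le_of_form hX (norm_nonneg _) fun v => (h v).trans (form_le_norm Y v)

theorem le_norm_of_form [NeZero k] {X : Matrix (Fin k) (Fin k) ℝ} {c : ℝ}
    (h : ∀ v, c * (v ⬝ᵥ v) ≤ v ⬝ᵥ (X *ᵥ v)) : c ≤ ‖X‖ := by
  -- The all-ones vector is nonzero because the dimension is positive.
  have h1 := (h 1).trans (form_le_norm X 1)
  refine le_of_mul_le_mul_right h1 ?_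
  simp [NeZero.pos]

theorem form_ge_of_spectrum {X : Matrix (Fin k) (Fin k) ℝ} (hX : Xᵀ = X) {c : ℝ}
    (h : ∀ μ ∈ spectrum ℝ X, c ≤ μ) (v : Fin k → ℝ) : c * (v ⬝ᵥ v) ≤ v ⬝ᵥ (X *ᵥ v) := by
  have hp : (X - algebraMap ℝ (Matrix (Fin k) (Fin k) ℝ) c).PosSemidef := by
    rw [Matrix.posSemidef_iff_isHermitian_and_spectrum_nonneg]
    constructor
    · rw [Matrix.IsHermitian, Matrix.conjTranspose_eq_transpose_of_trivial, Matrix.transpose_sub, hX]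
      simp [Matrix.algebraMap_eq_diagonal]
    · intro μ hμ
      have : μ + c ∈ spectrum ℝ X := by
        have := spectrum.add_mem_iff (r := μ) (s := c) (a := X)
        rw [this]
        simpa [sub_eq_neg_add] using hμ
      have := h _ this
      simp only [Set.mem_ofPred_eq]; linarith
  have := form_nonneg hp v
  rw [Matrix.sub_mulVec, dotProduct_sub, Algebra.algebraMap_eq_smul_one, Matrix.smul_mulVec,
    Matrix.one_mulVec, dotProduct_smul, smul_eq_mul] at this
  linarith

theorem exists_eigenvector {X : Matrix (Fin k) (Fin k) ℝ} {μ : ℝ} (h : μ ∈ spectrum ℝ X) :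
    ∃ v ≠ 0, X *ᵥ v = μ • v := by
  rw [← Matrix.spectrum_toLin', ← Module.End.hasEigenvalue_iff_mem_spectrum] at h
  obtain ⟨v, hv⟩ := h.exists_hasEigenvector
  exact ⟨v, hv.2, by simpa using hv.apply_eq_smul⟩

theorem dotProduct_self_pos {v : Fin k → ℝ} (hv : v ≠ 0) : 0 < v ⬝ᵥ v :=
  (dotProduct_self_nonneg' v).lt_of_ne' fun h => hv (dotProduct_self_eq_zero.1 h)

/-- If `M ⪰ c I` with `c > 0`, then `‖M⁻¹‖ ≤ 1 / c`. -/
theorem norm_inv_le {M : Matrix (Fin k) (Fin k) ℝ} (hM : M.PosDef) {c : ℝ} (hc : 0 < c)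
    (h : ∀ v, c * (v ⬝ᵥ v) ≤ v ⬝ᵥ (M *ᵥ v)) : ‖M⁻¹‖ ≤ 1 / c := by
  refine norm_le_of_mulVec (by positivity) fun w => ?_
  set u := M⁻¹ *ᵥ w with hu
  have hw : M *ᵥ u = w := by
    rw [hu, Matrix.mulVec_mulVec, Matrix.mul_nonsing_inv _ ((Matrix.isUnit_iff_isUnit_det _).1 hM.isUnit),
      Matrix.one_mulVec]
  have h1 := h u
  rw [hw] at h1
  have h2 := dotProduct_sq_le u w
  have h3 := dotProduct_self_nonneg' u
  rcases h3.eq_or_lt with h0 | h0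
  · rw [← h0]; have := dotProduct_self_nonneg' w; positivity
  · have h4 : (c * (u ⬝ᵥ u)) ^ 2 ≤ (u ⬝ᵥ u) * (w ⬝ᵥ w) :=
      (pow_le_pow_left₀ (by positivity) h1 2).trans h2
    have h5 : c ^ 2 * (u ⬝ᵥ u) ≤ w ⬝ᵥ w := by
      refine le_of_mul_le_mul_left ?_ h0
      linarith
    rw [div_pow, one_pow, div_mul_eq_mul_div, one_mul, le_div_iff₀ (by positivity)]
    linarith

/-- If `M ⪰ c BᵀB` with `c > 0`, then `‖B M⁻¹ Bᵀ‖ ≤ 1 / c`. -/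
theorem norm_mul_inv_mul_transpose_le {M : Matrix (Fin l) (Fin l) ℝ} (hM : M.PosDef) {c : ℝ} (hc : 0 < c)
    (B : Matrix (Fin k) (Fin l) ℝ) (h : ∀ v, c * ((B *ᵥ v) ⬝ᵥ (B *ᵥ v)) ≤ v ⬝ᵥ (M *ᵥ v)) :
    ‖B * M⁻¹ * Bᵀ‖ ≤ 1 / c := by
  refine norm_le_of_mulVec (by positivity) fun w => ?_
  set u := M⁻¹ *ᵥ (Bᵀ *ᵥ w) with hu
  have hw : M *ᵥ u = Bᵀ *ᵥ w := by
    rw [hu, Matrix.mulVec_mulVec, Matrix.mul_nonsing_inv _ ((Matrix.isUnit_iff_isUnit_det _).1 hM.isUnit),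
      Matrix.one_mulVec]
  have hz : (B * M⁻¹ * Bᵀ) *ᵥ w = B *ᵥ u := by
    rw [hu, Matrix.mulVec_mulVec, Matrix.mulVec_mulVec, Matrix.mul_assoc]
  rw [hz]
  -- With Mu = Bᵀw this reads c|Bu|² ≤ ⟨Bu, w⟩; Cauchy–Schwarz then bounds |Bu| without any factor
  -- ‖B‖.
  have h1 := h u
  rw [hw, Matrix.dotProduct_mulVec u, Matrix.vecMul_transpose] at h1
  have h2 := dotProduct_sq_le (B *ᵥ u) w
  have h3 := dotProduct_self_nonneg' (B *ᵥ u)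
  rcases h3.eq_or_lt with h0 | h0
  · rw [← h0]; have := dotProduct_self_nonneg' w; positivity
  · have h4 := (pow_le_pow_left₀ (by positivity) h1 2).trans h2
    have h5 : c ^ 2 * ((B *ᵥ u) ⬝ᵥ (B *ᵥ u)) ≤ w ⬝ᵥ w := by
      refine le_of_mul_le_mul_left ?_ h0
      linarith
    rw [div_pow, one_pow, div_mul_eq_mul_div, one_mul, le_div_iff₀ (by positivity)]
    linarith

end Forms

end LQR

/-! ### One-step policy evaluation, gains and the Riccati fixed point. -/

namespace LQR

noncomputable section

variable {n m : ℕ}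

/-- One step of policy evaluation: the quadratic cost matrix when the gain `K` is applied once and
the remaining cost is given by `S`. -/
def policyValue (A : Matrix (Fin n) (Fin n) ℝ) (B : Matrix (Fin n) (Fin m) ℝ)
    (Q : Matrix (Fin n) (Fin n) ℝ) (R : Matrix (Fin m) (Fin m) ℝ)
    (S : Matrix (Fin n) (Fin n) ℝ) (K : Matrix (Fin m) (Fin n) ℝ) : Matrix (Fin n) (Fin n) ℝ :=
  (A - B * K)ᵀ * S * (A - B * K) + Kᵀ * R * K + Q

/-- The quadratic cost matrix of the policies `Kt` with `k` steps remaining before the horizon. -/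
def costToGo (A : Matrix (Fin n) (Fin n) ℝ) (B : Matrix (Fin n) (Fin m) ℝ)
    (Q : Matrix (Fin n) (Fin n) ℝ) (R : Matrix (Fin m) (Fin m) ℝ) (QN : Matrix (Fin n) (Fin n) ℝ)
    (N : ℕ) (Kt : ℕ → Matrix (Fin m) (Fin n) ℝ) : ℕ → Matrix (Fin n) (Fin n) ℝ
  | 0 => QN
  | k + 1 => policyValue A B Q R (costToGo A B Q R QN N Kt k) (Kt (N - 1 - k))

variable {A : Matrix (Fin n) (Fin n) ℝ} {B : Matrix (Fin n) (Fin m) ℝ}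
  {Q : Matrix (Fin n) (Fin n) ℝ} {R : Matrix (Fin m) (Fin m) ℝ}
  {S P : Matrix (Fin n) (Fin n) ℝ}

theorem rde_succ (QN : Matrix (Fin n) (Fin n) ℝ) (k : ℕ) :
    rde A B Q R QN (k + 1) =
      policyValue A B Q R (rde A B Q R QN k) (gain A B R (rde A B Q R QN k)) := rfl

theorem form_policyValue (K : Matrix (Fin m) (Fin n) ℝ) (v : Fin n → ℝ) :
    v ⬝ᵥ (policyValue A B Q R S K *ᵥ v) =
      ((A - B * K) *ᵥ v) ⬝ᵥ (S *ᵥ ((A - B * K) *ᵥ v)) + (K *ᵥ v) ⬝ᵥ (R *ᵥ (K *ᵥ v))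
        + v ⬝ᵥ (Q *ᵥ v) := by
  rw [policyValue, Matrix.add_mulVec, Matrix.add_mulVec, dotProduct_add, dotProduct_add,
    form_mulVec, form_mulVec]

theorem conj_posSemidef {k l : ℕ} {X : Matrix (Fin k) (Fin k) ℝ} (hX : X.PosSemidef)
    (F : Matrix (Fin k) (Fin l) ℝ) : (Fᵀ * X * F).PosSemidef := by
  simpa using hX.conjTranspose_mul_mul_same F

theorem policyValue_posSemidef (hQ : Q.PosDef) (hR : R.PosDef) (hS : S.PosSemidef)
    (K : Matrix (Fin m) (Fin n) ℝ) : (policyValue A B Q R S K).PosSemidef :=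
  ((conj_posSemidef hS _).add (conj_posSemidef hR.posSemidef _)).add hQ.posSemidef

theorem inputWeight_posDef (hR : R.PosDef) (hS : S.PosSemidef) : (R + Bᵀ * S * B).PosDef :=
  hR.add_posSemidef (conj_posSemidef hS B)

theorem inputWeight_mul_gain (hR : R.PosDef) (hS : S.PosSemidef) :
    (R + Bᵀ * S * B) * gain A B R S = Bᵀ * S * A := by
  have h := (Matrix.isUnit_iff_isUnit_det _).1 (inputWeight_posDef (B := B) hR hS).isUnit
  rw [gain, ← Matrix.mul_assoc, ← Matrix.mul_assoc, ← Matrix.mul_assoc,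
    Matrix.mul_nonsing_inv _ h, Matrix.one_mul]

/-- Completion of the square in K: the linear terms match because M_S g_S = BᵀSA. The excess is
exact, so gain errors enter the cost only quadratically. -/
theorem policyValue_eq_add (hR : R.PosDef) (hS : S.PosSemidef) (K : Matrix (Fin m) (Fin n) ℝ) :
    policyValue A B Q R S K = policyValue A B Q R S (gain A B R S)
      + (K - gain A B R S)ᵀ * (R + Bᵀ * S * B) * (K - gain A B R S) := by
  have h1 := inputWeight_mul_gain (A := A) (B := B) hR hS
  set g := gain A B R S
  have hSt := transpose_eq hS
  have hRt := transpose_eq hR.posSemidef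
  have h2 : gᵀ * (R + Bᵀ * S * B) = Aᵀ * S * B := by
    have := congrArg Matrix.transpose h1
    simpa [Matrix.transpose_mul, hSt, hRt, Matrix.mul_assoc] using this
  have key : ∀ L : Matrix (Fin m) (Fin n) ℝ, policyValue A B Q R S L =
      Aᵀ * S * A - Aᵀ * S * B * L - Lᵀ * (Bᵀ * S * A) + Lᵀ * (R + Bᵀ * S * B) * L + Q := by
    intro L
    simp only [policyValue, Matrix.transpose_sub, Matrix.transpose_mul, Matrix.sub_mul,
      Matrix.mul_sub, Matrix.mul_add, Matrix.add_mul, Matrix.mul_assoc]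
    abel
  rw [key, key, ← h1, ← h2]
  simp only [Matrix.transpose_sub, Matrix.sub_mul, Matrix.mul_sub, Matrix.mul_assoc]
  abel

/-- The Riccati equation is the completed square read at K = 0, where the value is AᵀPA + Q and the
excess is gᵀMg = AᵀPB M⁻¹ BᵀPA. -/
theorem IsRiccatiSolution.policyValue_gain (hR : R.PosDef) (hP : IsRiccatiSolution A B Q R P) :
    policyValue A B Q R P (gain A B R P) = P := by
  have h := policyValue_eq_add (A := A) (Q := Q) (B := B) hR hP.1.posSemidef 0
  have h1 := inputWeight_mul_gain (A := A) (B := B) hR hP.1.posSemidef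
  have h2 : (gain A B R P)ᵀ = Aᵀ * P * B * (R + Bᵀ * P * B)⁻¹ := by
    have h3 := transpose_eq hP.1.posSemidef
    have h4 := transpose_eq (inputWeight_posDef (B := B) hR hP.1.posSemidef).posSemidef
    rw [gain, Matrix.transpose_mul, Matrix.transpose_mul, Matrix.transpose_mul,
      Matrix.transpose_nonsing_inv, h3, h4]
    simp [Matrix.mul_assoc]
  have h5 : policyValue A B Q R P 0 = Aᵀ * P * A + Q := by simp [policyValue]
  rw [h5] at h
  rw [zero_sub, Matrix.transpose_neg, Matrix.neg_mul, Matrix.neg_mul, Matrix.mul_neg, neg_neg, Matrix.mul_assoc (gain A B R P)ᵀ, h1,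
    h2] at h
  have h6 := hP.2
  rw [eq_sub_of_add_eq h.symm]
  conv_rhs => rw [h6]
  simp only [Matrix.mul_assoc]
  abel

/-- Multiply by M_S and replace R g_P by BᵀP(A - B g_P), the optimality equation of g_P. Only the
closed loop of P then appears. -/
theorem gain_sub_gain (hR : R.PosDef) (hS : S.PosSemidef) (hP : P.PosSemidef) :
    gain A B R S - gain A B R P =
      (R + Bᵀ * S * B)⁻¹ * Bᵀ * (S - P) * (A - B * gain A B R P) := by
  have h := (Matrix.isUnit_iff_isUnit_det _).1 (inputWeight_posDef (B := B) hR hS).isUnit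
  have h1 := inputWeight_mul_gain (A := A) (B := B) hR hS
  have h2 := inputWeight_mul_gain (A := A) (B := B) hR hP
  set g := gain A B R P
  have h3 : (R + Bᵀ * S * B) * (gain A B R S - g) = Bᵀ * (S - P) * (A - B * g) := by
    rw [Matrix.mul_sub, h1]
    have : R * g = Bᵀ * P * A - Bᵀ * P * B * g := by
      rw [← h2, Matrix.add_mul]; abel
    rw [Matrix.add_mul, this]
    simp only [Matrix.mul_sub, Matrix.sub_mul, Matrix.mul_assoc]
    abel
  rw [Matrix.mul_assoc, Matrix.mul_assoc, ← Matrix.mul_assoc Bᵀ, ← h3,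
    Matrix.nonsing_inv_mul_cancel_left _ _ h]

/-- Evaluating any gain on a cost above the Riccati solution stays above the Riccati solution. -/
theorem le_policyValue (hR : R.PosDef) (hP : IsRiccatiSolution A B Q R P)
    (hSP : (S - P).PosSemidef) (K : Matrix (Fin m) (Fin n) ℝ) (v : Fin n → ℝ) :
    v ⬝ᵥ (P *ᵥ v) ≤ v ⬝ᵥ (policyValue A B Q R S K *ᵥ v) := by
  -- Monotonicity in S reduces to S = P, where g_P attains the minimum P.
  have h1 := form_nonneg hSP ((A - B * K) *ᵥ v)
  rw [Matrix.sub_mulVec S, dotProduct_sub] at h1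
  have h2 := form_nonneg (conj_posSemidef (inputWeight_posDef (B := B) hR hP.1.posSemidef).posSemidef
    (K - gain A B R P)) v
  have h3 := congrArg (fun X => v ⬝ᵥ (X *ᵥ v))
    (policyValue_eq_add (A := A) (Q := Q) (B := B) hR hP.1.posSemidef K)
  simp only [hP.policyValue_gain hR, Matrix.add_mulVec _ _ v, dotProduct_add] at h3
  rw [form_policyValue] at h3 ⊢
  linarith

theorem policyValue_sub_posSemidef (hQ : Q.PosDef) (hR : R.PosDef)
    (hP : IsRiccatiSolution A B Q R P) (hSP : (S - P).PosSemidef) (K : Matrix (Fin m) (Fin n) ℝ) :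
    (policyValue A B Q R S K - P).PosSemidef := by
  have hS : S.PosSemidef := by simpa using hSP.add hP.1.posSemidef
  refine posSemidef_of_form ?_ fun v => ?_
  · rw [Matrix.transpose_sub, transpose_eq (policyValue_posSemidef hQ hR hS K),
      transpose_eq hP.1.posSemidef]
  · rw [Matrix.sub_mulVec, dotProduct_sub, sub_nonneg]
    exact le_policyValue hR hP hSP K v

/-- One step of policy evaluation, compared with the optimal closed loop. -/
theorem form_policyValue_sub_le (hR : R.PosDef) (hP : IsRiccatiSolution A B Q R P)
    (hSP : (S - P).PosSemidef) (K : Matrix (Fin m) (Fin n) ℝ) (v : Fin n → ℝ) :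
    v ⬝ᵥ ((policyValue A B Q R S K - P) *ᵥ v) ≤
      ((A - B * gain A B R P) *ᵥ v) ⬝ᵥ ((S - P) *ᵥ ((A - B * gain A B R P) *ᵥ v))
        + ‖R + Bᵀ * S * B‖ * ‖K - gain A B R S‖ ^ 2 * (v ⬝ᵥ v) := by
  have hS : S.PosSemidef := by simpa using hSP.add hP.1.posSemidef
  have hM := (inputWeight_posDef (B := B) hR hS).posSemidef
  have hf := fun L : Matrix (Fin m) (Fin n) ℝ => congrArg (fun X => v ⬝ᵥ (X *ᵥ v))
    (policyValue_eq_add (A := A) (Q := Q) (B := B) hR hS L)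
  simp only [Matrix.add_mulVec _ _ v, dotProduct_add] at hf
  have h1 := hf K
  -- The gain of P serves as a competitor to the minimizer for S; it brings in the fixed closed loop
  -- A - B g_P.
  have h2 := hf (gain A B R P)
  have h3 := form_nonneg (conj_posSemidef hM (gain A B R P - gain A B R S)) v
  have h4 := congrArg (fun X => v ⬝ᵥ (X *ᵥ v)) (hP.policyValue_gain hR)
  have h5 : v ⬝ᵥ (((K - gain A B R S)ᵀ * (R + Bᵀ * S * B) * (K - gain A B R S)) *ᵥ v) ≤
      ‖R + Bᵀ * S * B‖ * ‖K - gain A B R S‖ ^ 2 * (v ⬝ᵥ v) := by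
    rw [form_mulVec, mul_assoc]
    refine (form_le_norm _ _).trans ?_
    gcongr
    exact mulVec_dotProduct_self_le _ _
  rw [form_policyValue] at h2 h4
  rw [Matrix.sub_mulVec, dotProduct_sub, Matrix.sub_mulVec S, dotProduct_sub]
  linarith

/-- Lipschitz dependence of the gain on the cost matrix. -/
theorem norm_gain_sub_gain_le (hR : R.PosDef) (hS : S.PosSemidef) (hP : P.PosSemidef)
    {r : ℝ} (hr : 0 < r) (hRr : ∀ v, r * (v ⬝ᵥ v) ≤ v ⬝ᵥ (R *ᵥ v)) :
    ‖gain A B R S - gain A B R P‖ ≤ ‖B‖ * ‖A - B * gain A B R P‖ / r * ‖S - P‖ := by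
  rw [gain_sub_gain hR hS hP]
  have h1 : ‖(R + Bᵀ * S * B)⁻¹‖ ≤ 1 / r := by
    refine norm_inv_le (inputWeight_posDef (B := B) hR hS) hr fun v => ?_
    rw [Matrix.add_mulVec, dotProduct_add]
    linarith [hRr v, form_nonneg (conj_posSemidef hS B) v]
  calc _ ≤ ‖(R + Bᵀ * S * B)⁻¹‖ * ‖Bᵀ‖ * ‖S - P‖ * ‖A - B * gain A B R P‖ := by
        refine (Matrix.l2_opNorm_mul _ _).trans ?_
        gcongr
        refine (Matrix.l2_opNorm_mul _ _).trans ?_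
        gcongr
        exact Matrix.l2_opNorm_mul _ _
    _ ≤ 1 / r * ‖B‖ * ‖S - P‖ * ‖A - B * gain A B R P‖ := by
        rw [norm_transpose]; gcongr
    _ = _ := by ring

/-- The closed loop for the gain of `S` is close to the closed loop for the gain of `P`. -/
theorem norm_closedLoop_le (hR : R.PosDef) (hS : S.PosSemidef) (hP : P.PosSemidef)
    {c : ℝ} (hc : 0 < c) (hSc : ∀ v, c * (v ⬝ᵥ v) ≤ v ⬝ᵥ (S *ᵥ v)) :
    ‖A - B * gain A B R P‖ ≤ ‖A - B * gain A B R S‖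
      + 1 / c * ‖S - P‖ * ‖A - B * gain A B R P‖ := by
  have h1 : A - B * gain A B R P = (A - B * gain A B R S)
      + (B * (R + Bᵀ * S * B)⁻¹ * Bᵀ) * (S - P) * (A - B * gain A B R P) := by
    have := congrArg (fun X => B * X) (gain_sub_gain (A := A) (B := B) hR hS hP)
    simp only [Matrix.mul_sub B, ← Matrix.mul_assoc B] at this
    rw [← this]; abel
  have h2 : ‖B * (R + Bᵀ * S * B)⁻¹ * Bᵀ‖ ≤ 1 / c := by
    -- S ⪰ cI and R ⪰ 0 give M_S ⪰ c BᵀB.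
    refine norm_mul_inv_mul_transpose_le (inputWeight_posDef (B := B) hR hS) hc B fun v => ?_
    rw [Matrix.add_mulVec, dotProduct_add, form_mulVec]
    linarith [hSc (B *ᵥ v), form_nonneg hR.posSemidef v]
  calc _ = ‖(A - B * gain A B R S)
      + (B * (R + Bᵀ * S * B)⁻¹ * Bᵀ) * (S - P) * (A - B * gain A B R P)‖ := by rw [← h1]
    _ ≤ _ := by
      refine (norm_add_le _ _).trans ?_
      gcongr
      refine (Matrix.l2_opNorm_mul _ _).trans ?_
      gcongr
      refine (Matrix.l2_opNorm_mul _ _).trans ?_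
      gcongr

end

end LQR

/-! ### The surrogate costs and their minimizers. -/

namespace LQR

noncomputable section

variable {n m : ℕ}

variable {A : Matrix (Fin n) (Fin n) ℝ} {B : Matrix (Fin n) (Fin m) ℝ}
  {Q : Matrix (Fin n) (Fin n) ℝ} {R : Matrix (Fin m) (Fin m) ℝ}
  {S P QN : Matrix (Fin n) (Fin n) ℝ}

/-- Backward dynamic programming, by induction on the number k of remaining steps. The index j + 1
keeps away from the initial step, where `state` uses K instead of `Kt`. -/
theorem tail_cost_eq (N : ℕ) (Kt : ℕ → Matrix (Fin m) (Fin n) ℝ) (h : ℕ)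
    (K : Matrix (Fin m) (Fin n) ℝ) (x : Fin n → ℝ) (k : ℕ) :
    ∀ j, h + (j + 1) + k = N →
      (∑ t ∈ Finset.Ico (h + (j + 1)) N, state A B Kt h K x (t - h) ⬝ᵥ
          ((Q + (Kt t)ᵀ * R * Kt t) *ᵥ state A B Kt h K x (t - h)))
        + state A B Kt h K x (N - h) ⬝ᵥ (QN *ᵥ state A B Kt h K x (N - h)) =
      state A B Kt h K x (j + 1) ⬝ᵥ (costToGo A B Q R QN N Kt k *ᵥ state A B Kt h K x (j + 1)) := by
  induction k with
  | zero =>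
    intro j hj
    simp [← hj, costToGo]
  | succ k ih =>
    intro j hj
    have h1 := ih (j + 1) (by omega)
    rw [Finset.sum_eq_sum_Ico_succ_bot (by omega), add_assoc]
    rw [← add_assoc h (j + 1) 1] at h1
    rw [h1]
    have h2 : N - 1 - k = h + (j + 1) := by omega
    have h3 : h + (j + 1) - h = j + 1 := by omega
    rw [costToGo, form_policyValue, h2, h3, Matrix.add_mulVec, dotProduct_add, form_mulVec]
    rw [show state A B Kt h K x (j + 1 + 1) =
      (A - B * Kt (h + (j + 1))) *ᵥ state A B Kt h K x (j + 1) from rfl]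
    ring

theorem surrogateCost_eq (D : Measure (Fin n → ℝ)) {N h : ℕ} (hh : h < N)
    (Kt : ℕ → Matrix (Fin m) (Fin n) ℝ) (K : Matrix (Fin m) (Fin n) ℝ) :
    surrogateCost A B Q R QN D N Kt h K =
      ∫ x, x ⬝ᵥ (policyValue A B Q R (costToGo A B Q R QN N Kt (N - 1 - h)) K *ᵥ x) ∂D := by
  refine integral_congr_ae (.of_forall fun x => ?_)
  have h1 := tail_cost_eq (A := A) (B := B) (Q := Q) (R := R) (QN := QN) N Kt h K x (N - 1 - h) 0
    (by omega)
  simp only [zero_add] at h1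
  simp only [form_policyValue]
  rw [add_right_comm, h1, Matrix.add_mulVec, dotProduct_add, form_mulVec]
  simp only [state]
  ring

theorem IsInitialLaw.integrable_mul {D : Measure (Fin n → ℝ)} {S₀ : Matrix (Fin n) (Fin n) ℝ}
    {Cm : ℝ} (hD : IsInitialLaw D S₀ Cm) (i j : Fin n) : Integrable (fun x => x i * x j) D := by
  have := hD.isProbabilityMeasure
  refine Integrable.of_bound (C := Cm) (by fun_prop) ?_
  filter_upwards [hD.bounded] with x hx
  have hle : ∀ i, x i * x i ≤ Cm := fun i =>
    (Finset.single_le_sum (f := fun i => x i * x i) (fun _ _ => mul_self_nonneg _)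
      (Finset.mem_univ i)).trans hx
  rw [Real.norm_eq_abs, abs_le]
  constructor <;> nlinarith [hle i, hle j, sq_nonneg (x i - x j), sq_nonneg (x i + x j)]

theorem form_eq_sum (Z : Matrix (Fin n) (Fin n) ℝ) (x : Fin n → ℝ) :
    x ⬝ᵥ (Z *ᵥ x) = ∑ i, ∑ j, Z i j * (x i * x j) := by
  simp only [dotProduct, Matrix.mulVec, Finset.mul_sum]
  exact Finset.sum_congr rfl fun i _ => Finset.sum_congr rfl fun j _ => by ring

theorem IsInitialLaw.integrable_form {D : Measure (Fin n → ℝ)} {S₀ : Matrix (Fin n) (Fin n) ℝ}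
    {Cm : ℝ} (hD : IsInitialLaw D S₀ Cm) (Z : Matrix (Fin n) (Fin n) ℝ) :
    Integrable (fun x => x ⬝ᵥ (Z *ᵥ x)) D := by
  simp only [form_eq_sum]
  exact integrable_finsetSum _ fun i _ => integrable_finsetSum _ fun j _ =>
    (hD.integrable_mul i j).const_mul _

theorem IsInitialLaw.integral_form {D : Measure (Fin n → ℝ)} {S₀ : Matrix (Fin n) (Fin n) ℝ}
    {Cm : ℝ} (hD : IsInitialLaw D S₀ Cm) (Z : Matrix (Fin n) (Fin n) ℝ) :
    ∫ x, x ⬝ᵥ (Z *ᵥ x) ∂D = ∑ i, ∑ j, Z i j * S₀ i j := by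
  simp only [form_eq_sum]
  have hij := fun i j => (hD.integrable_mul i j).const_mul (Z i j)
  rw [integral_finsetSum]
  · refine Finset.sum_congr rfl fun i _ => ?_
    rw [integral_finsetSum]
    · refine Finset.sum_congr rfl fun j _ => ?_
      rw [integral_const_mul, hD.second_moment]
    · exact fun j _ => hij i j
  · exact fun i _ => integrable_finsetSum _ fun j _ => hij i j

/-- With M = LᵀL the expectation is the trace of (LF)ᵀ(LF)Σ₀, a sum of Σ₀-forms of the rows of LF.
Positive definiteness of Σ₀ kills each row. This gives uniqueness of the surrogate minimizer. -/
theorem eq_zero_of_integral_form_le {D : Measure (Fin n → ℝ)} {S₀ : Matrix (Fin n) (Fin n) ℝ}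
    {Cm : ℝ} (hD : IsInitialLaw D S₀ Cm) (hS₀ : S₀.PosDef) {M : Matrix (Fin m) (Fin m) ℝ}
    (hM : M.PosDef) {F : Matrix (Fin m) (Fin n) ℝ}
    (h : ∫ x, x ⬝ᵥ ((Fᵀ * M * F) *ᵥ x) ∂D ≤ 0) : F = 0 := by
  obtain ⟨L, rfl⟩ := exists_transpose_mul_self hM.posSemidef
  have hG : Fᵀ * (Lᵀ * L) * F = (L * F)ᵀ * (L * F) := by
    simp [Matrix.transpose_mul, Matrix.mul_assoc]
  rw [hG, hD.integral_form] at h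
  have h1 : ∑ i, ∑ j, ((L * F)ᵀ * (L * F)) i j * S₀ i j =
      ∑ k, (L * F) k ⬝ᵥ (S₀ *ᵥ (L * F) k) := by
    simp only [form_eq_sum, Matrix.mul_apply (M := (L * F)ᵀ), Matrix.transpose_apply,
      Finset.sum_mul]
    rw [Finset.sum_comm' (t' := Finset.univ) (s' := fun _ => Finset.univ) (by simp)]
    rw [Finset.sum_comm]
    rw [Finset.sum_congr rfl fun i _ => Finset.sum_comm]
    rw [Finset.sum_comm]
    exact Finset.sum_congr rfl fun k _ => Finset.sum_congr rfl fun i _ =>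
      Finset.sum_congr rfl fun j _ => by ring
  rw [h1] at h
  have h2 := (Finset.sum_eq_zero_iff_of_nonneg fun k _ =>
    form_nonneg hS₀.posSemidef ((L * F) k)).1
      (h.antisymm (Finset.sum_nonneg fun k _ => form_nonneg hS₀.posSemidef ((L * F) k)))
  have h3 : L * F = 0 := by
    ext k j
    by_contra hne
    have : (L * F) k ≠ 0 := fun h0 => hne (by rw [h0]; rfl)
    exact (form_pos hS₀ this).ne' (h2 k (Finset.mem_univ k))
  have h4 : (Lᵀ * L) * F = 0 := by rw [Matrix.mul_assoc, h3, Matrix.mul_zero]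
  have h5 := Matrix.nonsing_inv_mul_cancel_left (Lᵀ * L) F
    ((Matrix.isUnit_iff_isUnit_det _).1 hM.isUnit)
  rw [← h5, h4, Matrix.mul_zero]

theorem costToGo_sub_posSemidef (hQ : Q.PosDef) (hR : R.PosDef)
    (hP : IsRiccatiSolution A B Q R P) (hQN : (QN - P).PosSemidef) (N : ℕ)
    (Kt : ℕ → Matrix (Fin m) (Fin n) ℝ) (k : ℕ) :
    (costToGo A B Q R QN N Kt k - P).PosSemidef := by
  induction k with
  | zero => exact hQN
  | succ k ih => exact policyValue_sub_posSemidef hQ hR hP ih _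

/-- The minimizer of the surrogate cost is the one-step optimal gain. -/
theorem eq_gain_of_isMinOn (hR : R.PosDef)
    {D : Measure (Fin n → ℝ)} {S₀ : Matrix (Fin n) (Fin n) ℝ}
    {Cm : ℝ} (hD : IsInitialLaw D S₀ Cm) (hS₀ : S₀.PosDef) {N h : ℕ} (hh : h < N)
    {Kt : ℕ → Matrix (Fin m) (Fin n) ℝ} {K : Matrix (Fin m) (Fin n) ℝ}
    (hS : (costToGo A B Q R QN N Kt (N - 1 - h)).PosSemidef)
    (hK : IsMinOn (surrogateCost A B Q R QN D N Kt h) Set.univ K) :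
    K = gain A B R (costToGo A B Q R QN N Kt (N - 1 - h)) := by
  set S := costToGo A B Q R QN N Kt (N - 1 - h)
  have h1 : surrogateCost A B Q R QN D N Kt h K ≤ surrogateCost A B Q R QN D N Kt h (gain A B R S) :=
    hK (Set.mem_univ _)
  rw [surrogateCost_eq D hh, surrogateCost_eq D hh, policyValue_eq_add hR hS K] at h1
  simp only [Matrix.add_mulVec _ _ _, dotProduct_add] at h1
  rw [integral_add (hD.integrable_form _) (hD.integrable_form _)] at h1
  have h2 : K - gain A B R S = 0 :=
    eq_zero_of_integral_form_le hD hS₀ (inputWeight_posDef (B := B) hR hS) (by linarith)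
  exact sub_eq_zero.1 h2

end

end LQR

/-! ### Spectral constants, induced norms and stability. -/

namespace LQR

section Constants

variable {k : ℕ}

theorem lambdaMin_le {X : Matrix (Fin k) (Fin k) ℝ} {μ : ℝ} (hμ : μ ∈ spectrum ℝ X) :
    lambdaMin X ≤ μ :=
  csInf_le X.finite_real_spectrum.bddBelow hμ

theorem lambdaMin_mul_le_form {X : Matrix (Fin k) (Fin k) ℝ} (hX : X.PosSemidef) (v : Fin k → ℝ) :
    lambdaMin X * (v ⬝ᵥ v) ≤ v ⬝ᵥ (X *ᵥ v) :=
  form_ge_of_spectrum (transpose_eq hX) (fun _ hμ => lambdaMin_le hμ) v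

theorem lambdaMin_mem_spectrum [NeZero k] {X : Matrix (Fin k) (Fin k) ℝ} (hX : X.PosSemidef) :
    lambdaMin X ∈ spectrum ℝ X := by
  refine Set.Nonempty.csInf_mem ?_ X.finite_real_spectrum
  exact ⟨_, hX.1.eigenvalues_mem_spectrum_real 0⟩

theorem pos_of_mem_spectrum {X : Matrix (Fin k) (Fin k) ℝ} (hX : X.PosDef) {μ : ℝ}
    (hμ : μ ∈ spectrum ℝ X) : 0 < μ := by
  obtain ⟨v, hv, h⟩ := exists_eigenvector hμ
  have h1 := form_pos hX hv
  rw [h, dotProduct_smul, smul_eq_mul] at h1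
  exact pos_of_mul_pos_left h1 (dotProduct_self_nonneg' v)

theorem lambdaMin_pos [NeZero k] {X : Matrix (Fin k) (Fin k) ℝ} (hX : X.PosDef) :
    0 < lambdaMin X :=
  pos_of_mem_spectrum hX (lambdaMin_mem_spectrum hX.posSemidef)

theorem sigmaMin_pos [NeZero k] {X : Matrix (Fin k) (Fin k) ℝ} (hX : X.PosDef) :
    0 < sigmaMin X := by
  refine Real.sqrt_pos.2 (lambdaMin_pos ?_)
  have h := Matrix.PosDef.conjTranspose_mul_mul_same (A := (1 : Matrix (Fin k) (Fin k) ℝ)) (B := X)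
    .one (Matrix.mulVec_injective_of_isUnit hX.isUnit)
  simpa using h

/-- For positive definite X every eigenvalue dominates σ_min: its eigenvector, tested in XᵀX, gives
λ_min(XᵀX) ≤ μ². -/
theorem sigmaMin_mul_le_form {X : Matrix (Fin k) (Fin k) ℝ} (hX : X.PosDef) (v : Fin k → ℝ) :
    sigmaMin X * (v ⬝ᵥ v) ≤ v ⬝ᵥ (X *ᵥ v) := by
  refine form_ge_of_spectrum (transpose_eq hX.posSemidef) (fun μ hμ => ?_) v
  obtain ⟨v, hv, h⟩ := exists_eigenvector hμ
  have h0 := pos_of_mem_spectrum hX hμ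
  have h1 : lambdaMin (Xᵀ * X) ≤ μ ^ 2 := by
    refine le_of_mul_le_mul_right ?_ (dotProduct_self_pos hv)
    have h2 := lambdaMin_mul_le_form (X := Xᵀ * X)
      (by simpa using Matrix.posSemidef_conjTranspose_mul_self X) v
    rw [form_transpose_mul_self, h] at h2
    simpa [sq, mul_assoc] using h2
  exact Real.sqrt_le_iff.2 ⟨h0.le, h1⟩

/-- If W = LᵀL then v = L⁻¹(Lv), and ‖W⁻¹‖ = ‖L⁻¹‖². -/
theorem form_le_norm_inv_mul_form {W : Matrix (Fin k) (Fin k) ℝ} (hW : W.PosDef) (v : Fin k → ℝ) :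
    v ⬝ᵥ v ≤ ‖W⁻¹‖ * (v ⬝ᵥ (W *ᵥ v)) := by
  have h1 : W⁻¹ *ᵥ (W *ᵥ v) = v := by
    rw [Matrix.mulVec_mulVec, Matrix.nonsing_inv_mul _ ((Matrix.isUnit_iff_isUnit_det _).1 hW.isUnit),
      Matrix.one_mulVec]
  obtain ⟨L, hL⟩ := exists_transpose_mul_self hW.posSemidef
  have hu : IsUnit L.det := by
    have := (Matrix.isUnit_iff_isUnit_det _).1 hW.isUnit
    rw [hL, Matrix.det_mul] at this
    exact isUnit_of_mul_isUnit_right this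
  have h2 : L⁻¹ *ᵥ (L *ᵥ v) = v := by
    rw [Matrix.mulVec_mulVec, Matrix.nonsing_inv_mul _ hu, Matrix.one_mulVec]
  have h3 : ‖W⁻¹‖ = ‖L⁻¹‖ ^ 2 := by
    rw [hL, Matrix.mul_inv_rev, ← norm_transpose L⁻¹, ← norm_transpose_mul_self,
      Matrix.transpose_transpose, Matrix.transpose_nonsing_inv]
  calc v ⬝ᵥ v = (L⁻¹ *ᵥ (L *ᵥ v)) ⬝ᵥ (L⁻¹ *ᵥ (L *ᵥ v)) := by rw [h2]
    _ ≤ ‖L⁻¹‖ ^ 2 * ((L *ᵥ v) ⬝ᵥ (L *ᵥ v)) := mulVec_dotProduct_self_le _ _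
    _ = _ := by rw [h3, ← form_transpose_mul_self, ← hL]

theorem inducedNorm_nonneg (W X : Matrix (Fin k) (Fin k) ℝ) : 0 ≤ inducedNorm W X :=
  Real.sqrt_nonneg _

theorem form_mulVec_le_inducedNorm {W : Matrix (Fin k) (Fin k) ℝ} (hW : W.PosDef)
    (X : Matrix (Fin k) (Fin k) ℝ) (v : Fin k → ℝ) :
    (X *ᵥ v) ⬝ᵥ (W *ᵥ (X *ᵥ v)) ≤ inducedNorm W X ^ 2 * (v ⬝ᵥ (W *ᵥ v)) := by
  rcases eq_or_ne v 0 with rfl | hv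
  · simp
  have hnn : ∀ z : {z : Fin k → ℝ // z ≠ 0},
      0 ≤ (z.1 ⬝ᵥ ((Xᵀ * W * X) *ᵥ z.1)) / (z.1 ⬝ᵥ (W *ᵥ z.1)) := fun z =>
    div_nonneg (form_nonneg (conj_posSemidef hW.posSemidef X) _) (form_nonneg hW.posSemidef _)
  -- Boundedness has to be shown, since an unbounded real supremum defaults to 0.
  have hb : BddAbove (Set.range fun z : {z : Fin k → ℝ // z ≠ 0} =>
      (z.1 ⬝ᵥ ((Xᵀ * W * X) *ᵥ z.1)) / (z.1 ⬝ᵥ (W *ᵥ z.1))) := by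
    refine ⟨‖Xᵀ * W * X‖ * ‖W⁻¹‖, ?_⟩
    rintro _ ⟨z, rfl⟩
    rw [div_le_iff₀ (form_pos hW z.2), mul_assoc ‖Xᵀ * W * X‖]
    exact (form_le_norm _ _).trans
      (mul_le_mul_of_nonneg_left (form_le_norm_inv_mul_form hW _) (norm_nonneg _))
  rw [inducedNorm, Real.sq_sqrt (Real.iSup_nonneg hnn), ← form_mulVec,
    ← div_le_iff₀ (form_pos hW hv)]
  exact le_ciSup hb ⟨v, hv⟩

theorem inducedNorm_sq_le [NeZero k] {W X : Matrix (Fin k) (Fin k) ℝ} (hW : W.PosDef) {c : ℝ}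
    (h : ∀ v, (X *ᵥ v) ⬝ᵥ (W *ᵥ (X *ᵥ v)) ≤ c * (v ⬝ᵥ (W *ᵥ v))) : inducedNorm W X ^ 2 ≤ c := by
  have : Nonempty {z : Fin k → ℝ // z ≠ 0} := ⟨⟨1, one_ne_zero⟩⟩
  rw [inducedNorm, Real.sq_sqrt]
  · refine ciSup_le fun z => ?_
    rw [div_le_iff₀ (form_pos hW z.2), form_mulVec]
    exact h z.1
  · exact Real.iSup_nonneg fun z =>
      div_nonneg (form_nonneg (conj_posSemidef hW.posSemidef X) _) (form_nonneg hW.posSemidef _)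

/-- The spectral norm of a positive semidefinite matrix is at most any of its induced norms. -/
theorem norm_le_inducedNorm {W D : Matrix (Fin k) (Fin k) ℝ} (hW : W.PosDef)
    (hD : D.PosSemidef) : ‖D‖ ≤ inducedNorm W D := by
  refine norm_le_of_form hD (inducedNorm_nonneg _ _) fun v => ?_
  -- `form_ge_of_spectrum` bounds forms from below, so it is applied to -D. An eigenvector of D with
  -- eigenvalue -μ yields μ² ≤ ‖D‖_W².
  have h : ∀ μ ∈ spectrum ℝ (-D), -inducedNorm W D ≤ μ := by
    intro μ hμ
    obtain ⟨v, hv, h⟩ := exists_eigenvector hμ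
    have h1 : D *ᵥ v = (-μ) • v := by
      rw [neg_smul, ← h, Matrix.neg_mulVec, neg_neg]
    have h2 := form_mulVec_le_inducedNorm hW D v
    rw [h1, Matrix.mulVec_smul, dotProduct_smul, smul_dotProduct, smul_eq_mul, smul_eq_mul,
      ← mul_assoc] at h2
    have h3 := le_of_mul_le_mul_right h2 (form_pos hW hv)
    have h4 : (-μ) ^ 2 ≤ inducedNorm W D ^ 2 := by rw [sq (-μ)]; exact h3
    linarith [abs_le_of_sq_le_sq h4 (inducedNorm_nonneg W D), le_abs_self (-μ),
      (abs_le_of_sq_le_sq' h4 (inducedNorm_nonneg W D)).2]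
  have := form_ge_of_spectrum (by rw [Matrix.transpose_neg, transpose_eq hD]) h v
  rw [Matrix.neg_mulVec, dotProduct_neg] at this
  linarith

/-- A matrix that contracts a positive definite quadratic form is stable. -/
theorem isStable_of_contraction [NeZero k] {W X : Matrix (Fin k) (Fin k) ℝ} (hW : W.PosDef) {c : ℝ}
    (hc : c < 1) (h : ∀ v, (X *ᵥ v) ⬝ᵥ (W *ᵥ (X *ᵥ v)) ≤ c * (v ⬝ᵥ (W *ᵥ v))) : IsStable X := by
  refine spectrum.spectralRadius_lt_of_forall_lt (r := 1) _ fun z hz => ?_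
  rw [← Matrix.spectrum_toLin', ← Module.End.hasEigenvalue_iff_mem_spectrum] at hz
  obtain ⟨v, hv⟩ := hz.exists_hasEigenvector
  have hv0 := hv.2
  have hv1 : (X.map (algebraMap ℝ ℂ)) *ᵥ v = z • v := by simpa using hv.apply_eq_smul
  -- The contraction is tested on the real and imaginary parts of a complex eigenvector; their cross
  -- terms cancel in the sum, leaving |z|².
  set x : Fin k → ℝ := fun i => (v i).re with hx
  set y : Fin k → ℝ := fun i => (v i).im with hy
  have hXx : X *ᵥ x = z.re • x - z.im • y := by
    ext i
    have := congrArg Complex.re (congrFun hv1 i)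
    simpa [Matrix.mulVec, dotProduct, hx, hy] using this
  have hXy : X *ᵥ y = z.re • y + z.im • x := by
    ext i
    have := congrArg Complex.im (congrFun hv1 i)
    simpa [Matrix.mulVec, dotProduct, hx, hy] using this
  have h1 := h x
  have h2 := h y
  rw [hXx] at h1
  rw [hXy] at h2
  simp only [Matrix.mulVec_sub, Matrix.mulVec_add, Matrix.mulVec_smul, dotProduct_sub,
    dotProduct_add, sub_dotProduct, add_dotProduct, smul_dotProduct, dotProduct_smul,
    smul_eq_mul] at h1 h2
  have h3 : 0 < x ⬝ᵥ (W *ᵥ x) + y ⬝ᵥ (W *ᵥ y) := by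
    rcases eq_or_ne x 0 with h0 | h0
    · have hy0 : y ≠ 0 := by
        rintro h00
        refine hv0 (funext fun i => Complex.ext ?_ ?_)
        · exact congrFun h0 i
        · exact congrFun h00 i
      have := form_pos hW hy0
      have := form_nonneg hW.posSemidef x
      positivity
    · have := form_pos hW h0
      have := form_nonneg hW.posSemidef y
      positivity
  have h4 : Complex.normSq z * (x ⬝ᵥ (W *ᵥ x) + y ⬝ᵥ (W *ᵥ y)) ≤
      c * (x ⬝ᵥ (W *ᵥ x) + y ⬝ᵥ (W *ᵥ y)) := by
    rw [Complex.normSq_apply]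
    linarith
  have h5 := le_of_mul_le_mul_right h4 h3
  rw [← NNReal.coe_lt_coe, coe_nnnorm, NNReal.coe_one]
  rw [Complex.normSq_eq_norm_sq] at h5
  exact (sq_lt_one_iff₀ (norm_nonneg z)).1 (h5.trans_lt hc)

/-- Perturbing `X` by `Y` changes the contraction factor of a quadratic form by at most
`√κ ‖Y‖`. -/
theorem isStable_add [NeZero k] {W X Y : Matrix (Fin k) (Fin k) ℝ} (hW : W.PosDef)
    (h : inducedNorm W X + Real.sqrt (condNumber W) * ‖Y‖ < 1) : IsStable (X + Y) := by
  set c := inducedNorm W X + Real.sqrt (condNumber W) * ‖Y‖ with hc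
  have hc0 : 0 ≤ c := add_nonneg (inducedNorm_nonneg _ _) (by positivity)
  refine isStable_of_contraction hW (c := c ^ 2) ((sq_lt_one_iff₀ hc0).2 h) fun v => ?_
  have hX := form_mulVec_le_inducedNorm hW X v
  have hY : (Y *ᵥ v) ⬝ᵥ (W *ᵥ (Y *ᵥ v)) ≤
      (Real.sqrt (condNumber W) * ‖Y‖) ^ 2 * (v ⬝ᵥ (W *ᵥ v)) := by
    rw [mul_pow, Real.sq_sqrt (by unfold condNumber; positivity), condNumber]
    calc _ ≤ ‖W‖ * ((Y *ᵥ v) ⬝ᵥ (Y *ᵥ v)) := form_le_norm _ _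
      _ ≤ ‖W‖ * (‖Y‖ ^ 2 * (v ⬝ᵥ v)) := by gcongr; exact mulVec_dotProduct_self_le _ _
      _ ≤ ‖W‖ * (‖Y‖ ^ 2 * (‖W⁻¹‖ * (v ⬝ᵥ (W *ᵥ v)))) := by
        gcongr; exact form_le_norm_inv_mul_form hW v
      _ = _ := by ring
  -- The W-form is the square of the seminorm |Lv|, so the triangle inequality applies.
  obtain ⟨L, hL⟩ := exists_transpose_mul_self hW.posSemidef
  simp only [hL, form_transpose_mul_self, dotProduct_self_eq_norm_sq, ← mul_pow] at hX hY ⊢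
  have hn := inducedNorm_nonneg W X
  rw [← hL, sq_le_sq₀ (by positivity) (by positivity)] at hX hY
  rw [sq_le_sq₀ (by positivity) (by positivity), Matrix.add_mulVec, Matrix.mulVec_add,
    WithLp.toLp_add, hc, add_mul]
  exact (norm_add_le _ _).trans (add_le_add hX hY)

end Constants

end LQR

/-! ### The scalar error recursion and the truncated Riccati iteration. -/

namespace LQR

/-- With x = 1/(2e) ≤ 1/5, the power is at most eˣ ≤ 1/(1 - x) ≤ 5/4. -/
theorem one_add_pow_le_five_quarters {N k : ℕ} (hk : k ≤ N) :
    (1 + 1 / (2 * Real.exp 1 * N)) ^ k ≤ 5 / 4 := by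
  have he := Real.exp_one_gt_d9
  rcases Nat.eq_zero_or_pos N with rfl | hN
  · norm_num
  have hN' : (0 : ℝ) < N := by exact_mod_cast hN
  set x : ℝ := 1 / (2 * Real.exp 1) with hx
  have hx0 : 0 < x := by positivity
  have hx1 : x ≤ 1 / 5 := by
    rw [hx]
    exact one_div_le_one_div_of_le (by norm_num) (by linarith)
  have h1 : 1 + 1 / (2 * Real.exp 1 * N) ≤ Real.exp (x / N) := by
    have := Real.add_one_le_exp (x / N)
    rw [hx, div_div] at this
    rw [hx, div_div]
    linarith
  have h2 : Real.exp (-x) * Real.exp x = 1 := by rw [← Real.exp_add]; simp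
  have h3 := Real.add_one_le_exp (-x)
  have h4 := Real.exp_pos x
  calc (1 + 1 / (2 * Real.exp 1 * N)) ^ k ≤ Real.exp (x / N) ^ k := by gcongr
    _ ≤ Real.exp (x / N) ^ N :=
      pow_le_pow_right₀ (Real.one_le_exp (by positivity)) hk
    _ = Real.exp x := by rw [← Real.exp_nat_mul]; congr 1; field_simp
    _ ≤ 5 / 4 := by nlinarith

/-- A bound for the perturbed scalar recursion `s ↦ ρ² s + ν (1 + s)` whose first step is
`δ ↦ ρ² δ + ν`. -/
theorem perturbed_recursion_bound {b : ℕ → ℝ → Prop} {N : ℕ} {ρ δ ν a q : ℝ} (hN : 1 ≤ N)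
    (hmono : ∀ k s t, b k s → s ≤ t → b k t) (h0 : b 0 δ) (h1 : 1 < N → b 1 (ρ ^ 2 * δ + ν))
    (hstep : ∀ k s, k + 1 < N → 0 ≤ s → b k s → b (k + 1) (ρ ^ 2 * s + ν * (1 + s)))
    (hρ0 : 0 ≤ ρ) (hρ1 : ρ ≤ 1) (hδ0 : 0 ≤ δ) (hν : 0 ≤ ν) (ha : 0 < a) (hq : 2 * a ≤ q)
    (hδ : δ * (2 * a) ≤ q) (hνq : 8 * Real.exp 1 * N * q * ν ≤ a) :
    b (N - 1) (5 / 4 * ((ρ ^ 2) ^ (N - 1) * δ) + 2 * N * ν) := by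
  have he := Real.exp_one_gt_d9
  have hN' : (1 : ℝ) ≤ N := by exact_mod_cast hN
  have hq0 : 0 < q := by linarith
  set σ := ρ ^ 2 with hσ
  have hσ0 : 0 ≤ σ := by positivity
  have hσ1 : σ ≤ 1 := pow_le_one₀ hρ0 hρ1
  rcases le_total a (4 * q * σ) with hc | hc
  -- When σ is not small, ν ≤ σ/(2eN): the multiplicative part of the perturbation is absorbed into
  -- the contraction factor, at a total cost of θ^(N-1) ≤ 5/4.
  · set θ := 1 + 1 / (2 * Real.exp 1 * N) with hθ
    have hθ1 : 1 ≤ θ := by rw [hθ]; linarith [show 0 ≤ 1 / (2 * Real.exp 1 * N) by positivity]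
    have hνσ : σ + ν ≤ σ * θ := by
      have : ν ≤ σ * (1 / (2 * Real.exp 1 * N)) := by
        rw [mul_one_div, le_div_iff₀ (by positivity)]
        have : (4 * q) * (ν * (2 * Real.exp 1 * N)) ≤ (4 * q) * σ := by linarith
        exact le_of_mul_le_mul_left this (by positivity)
      rw [hθ]; linarith
    have key : ∀ k, k < N → b k (θ ^ k * (σ ^ k * δ + k * ν)) := by
      intro k
      induction k with
      | zero => intro _; simpa using h0
      | succ k ih =>
        intro hk
        have hs : 0 ≤ θ ^ k * (σ ^ k * δ + k * ν) := by positivity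
        refine hmono _ _ _ (hstep k _ hk hs (ih (by omega))) ?_
        have e1 : (σ + ν) * (θ ^ k * (σ ^ k * δ + k * ν)) ≤
            (σ * θ) * (θ ^ k * (σ ^ k * δ + k * ν)) := by gcongr
        have e2 : σ * (k * ν) ≤ 1 * (k * ν) := by gcongr
        have e3 : θ ^ (k + 1) * (σ * (k * ν)) ≤ θ ^ (k + 1) * (1 * (k * ν)) := by gcongr
        have e4 : 1 * ν ≤ θ ^ (k + 1) * ν := by gcongr; exact one_le_pow₀ hθ1
        push_cast
        calc σ * (θ ^ k * (σ ^ k * δ + k * ν)) + ν * (1 + θ ^ k * (σ ^ k * δ + k * ν))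
            = (σ + ν) * (θ ^ k * (σ ^ k * δ + k * ν)) + 1 * ν := by ring
          _ ≤ (σ * θ) * (θ ^ k * (σ ^ k * δ + k * ν)) + θ ^ (k + 1) * ν := add_le_add e1 e4
          _ = θ ^ (k + 1) * (σ ^ (k + 1) * δ) + θ ^ (k + 1) * (σ * (k * ν))
              + θ ^ (k + 1) * ν := by ring
          _ ≤ _ := by linarith
    refine hmono _ _ _ (key (N - 1) (by omega)) ?_
    have e1 := one_add_pow_le_five_quarters (N := N) (k := N - 1) (by omega)
    have e2 : ((N - 1 : ℕ) : ℝ) ≤ N := by exact_mod_cast Nat.sub_le N 1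
    calc θ ^ (N - 1) * (σ ^ (N - 1) * δ + (N - 1 : ℕ) * ν)
        ≤ 5 / 4 * (σ ^ (N - 1) * δ + N * ν) := by gcongr
      _ ≤ _ := by
        have : 0 ≤ N * ν := by positivity
        linarith
  -- When σ is small, one step already brings the error below 1, and from then on ν(1 + s) ≤ 2ν. The
  -- initial δ may be large, so the first step must carry ν without the factor 1 + δ.
  · have hσδ : σ * δ ≤ 1 / 8 := by
      have e1 : σ * (δ * (2 * a)) ≤ σ * q := by gcongr
      have e2 : a * (8 * (σ * δ)) ≤ a * 1 := by linarith
      linarith [le_of_mul_le_mul_left e2 ha]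
    have hNν : N * ν ≤ 1 / 16 := by
      have e1 : (2 * a) * (8 * Real.exp 1 * (N * ν)) ≤ q * (8 * Real.exp 1 * (N * ν)) := by gcongr
      have e2 : a * (16 * Real.exp 1 * (N * ν)) ≤ a * 1 := by linarith
      have e3 := le_of_mul_le_mul_left e2 ha
      have e4 : 1 * (N * ν) ≤ Real.exp 1 * (N * ν) := by gcongr; linarith
      linarith
    have key : ∀ k, k < N → b k (σ ^ k * δ + 2 * k * ν) := by
      intro k
      induction k with
      | zero => intro _; simpa using h0
      | succ k ih =>
        intro hk
        rcases Nat.eq_zero_or_pos k with rfl | hk0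
        · refine hmono _ _ _ (h1 hk) ?_
          push_cast; linarith
        · have hs : 0 ≤ σ ^ k * δ + 2 * k * ν := by positivity
          refine hmono _ _ _ (hstep k _ hk hs (ih (by omega))) ?_
          have e0 : σ ^ k * δ ≤ σ * δ := by
            have : σ ^ k ≤ σ ^ 1 := pow_le_pow_of_le_one hσ0 hσ1 hk0
            rw [pow_one] at this
            gcongr
          have e1 : (k : ℝ) * ν ≤ N * ν := by
            gcongr; omega
          have e2 : σ ^ k * δ + 2 * k * ν ≤ 1 := by linarith
          have e3 : ν * (σ ^ k * δ + 2 * k * ν) ≤ ν * 1 := by gcongr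
          have e4 : σ * (k * ν) ≤ 1 * (k * ν) := by gcongr
          push_cast
          calc σ * (σ ^ k * δ + 2 * k * ν) + ν * (1 + (σ ^ k * δ + 2 * k * ν))
              = σ ^ (k + 1) * δ + 2 * (σ * (k * ν)) + ν
                + ν * (σ ^ k * δ + 2 * k * ν) := by ring
            _ ≤ _ := by linarith
    refine hmono _ _ _ (key (N - 1) (by omega)) ?_
    have e2 : ((N - 1 : ℕ) : ℝ) * ν ≤ N * ν := by gcongr; omega
    have e3 : 0 ≤ σ ^ (N - 1) * δ := by positivity
    linarith

theorem mul_pow_le_one_of_log {x ρ : ℝ} {N : ℕ} (hN : 1 ≤ N) (hx : 0 < x) (hρ : 0 < ρ)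
    (hρ1 : ρ < 1) (h : 1 / 2 * (Real.log x / Real.log (1 / ρ)) + 1 ≤ N) :
    x * (ρ ^ 2) ^ (N - 1) ≤ 1 := by
  have hl : 0 < Real.log (1 / ρ) := Real.log_pos (by rw [lt_div_iff₀ hρ]; linarith)
  have hc : ((N - 1 : ℕ) : ℝ) = N - 1 := by push_cast [hN]; ring
  have h1 : Real.log x ≤ (2 * (N - 1 : ℕ)) * Real.log (1 / ρ) := by
    rw [← div_le_iff₀ hl, hc]; linarith
  rw [one_div, Real.log_inv] at h1
  have h2 : Real.log (x * (ρ ^ 2) ^ (N - 1)) ≤ 0 := by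
    rw [Real.log_mul hx.ne' (by positivity), Real.log_pow, Real.log_pow]
    push_cast
    linarith
  exact (Real.log_nonpos_iff (by positivity)).1 h2

/-- Unpacks the logarithm's argument in the horizon bound: d is the spectral norm of QN - P, d' its
induced norm, and p, q are the factors of the condition number. -/
theorem half_bound_of_scaled {b k r p q d d' t ε : ℝ} (hb : 0 ≤ b) (hk : 0 ≤ k) (hr : 0 < r)
    (hp : 0 ≤ p) (hq : 0 ≤ q) (ht : 0 ≤ t) (hε : 0 < ε) (hd : d ≤ d')
    (h : 2 * d' * (q * p) * k * b / (ε * r) * t ≤ 1) : b * k / r * (t * (p * d) * q) ≤ ε / 2 :=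
  calc b * k / r * (t * (p * d) * q) ≤ b * k / r * (t * (p * d') * q) := by gcongr
    _ = ε / 2 * (2 * d' * (q * p) * k * b / (ε * r) * t) := by field_simp
    _ ≤ ε / 2 * 1 := by gcongr
    _ = ε / 2 := mul_one _

noncomputable section

variable {n m : ℕ} {A : Matrix (Fin n) (Fin n) ℝ} {B : Matrix (Fin n) (Fin m) ℝ}
  {Q : Matrix (Fin n) (Fin n) ℝ} {R : Matrix (Fin m) (Fin m) ℝ}
  {S P QN : Matrix (Fin n) (Fin n) ℝ}

theorem constA_pos [NeZero n] (hQ : Q.PosDef) : 0 < constA Q := half_pos (sigmaMin_pos hQ)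

/-- P = V_P(g_P) ⪰ Q ⪰ σ_min(Q) I, and σ_min(Q) = 2a. -/
theorem IsRiccatiSolution.two_constA_le_form (hQ : Q.PosDef) (hR : R.PosDef)
    (hP : IsRiccatiSolution A B Q R P) (v : Fin n → ℝ) :
    2 * constA Q * (v ⬝ᵥ v) ≤ v ⬝ᵥ (P *ᵥ v) := by
  have h1 := sigmaMin_mul_le_form hQ v
  have h2 := congrArg (fun X => v ⬝ᵥ (X *ᵥ v)) (hP.policyValue_gain hR)
  rw [form_policyValue] at h2
  have h3 := form_nonneg hP.1.posSemidef ((A - B * gain A B R P) *ᵥ v)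
  have h4 := form_nonneg hR.posSemidef (gain A B R P *ᵥ v)
  have h5 : 2 * constA Q = sigmaMin Q := by unfold constA; ring
  rw [h5]
  linarith

/-- Along the optimal closed loop the P-form drops by at least the Q-form, hence by the fraction
σ_min(Q)/‖P‖ of itself. -/
theorem IsRiccatiSolution.inducedNorm_lt_one [NeZero n] (hQ : Q.PosDef) (hR : R.PosDef)
    (hP : IsRiccatiSolution A B Q R P) : inducedNorm P (A - B * gain A B R P) < 1 := by
  have ha := sigmaMin_pos hQ
  have hP0 : 0 < ‖P‖ := (mul_pos two_pos (constA_pos hQ)).trans_le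
    (le_norm_of_form (hP.two_constA_le_form hQ hR))
  rw [← sq_lt_one_iff₀ (inducedNorm_nonneg _ _)]
  refine (inducedNorm_sq_le hP.1 (c := 1 - sigmaMin Q / ‖P‖) fun v => ?_).trans_lt
    (by linarith [div_pos ha hP0])
  have h2 := congrArg (fun X => v ⬝ᵥ (X *ᵥ v)) (hP.policyValue_gain hR)
  rw [form_policyValue] at h2
  have h4 := form_nonneg hR.posSemidef (gain A B R P *ᵥ v)
  have h5 := sigmaMin_mul_le_form hQ v
  have h6 : sigmaMin Q / ‖P‖ * (v ⬝ᵥ (P *ᵥ v)) ≤ sigmaMin Q / ‖P‖ * (‖P‖ * (v ⬝ᵥ v)) := by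
    gcongr; exact form_le_norm P v
  rw [← mul_assoc, div_mul_cancel₀ _ hP0.ne'] at h6
  linarith

theorem norm_sub_le_of_form (hSP : (S - P).PosSemidef) {s : ℝ} (hs : 0 ≤ s)
    (h : ∀ v, v ⬝ᵥ ((S - P) *ᵥ v) ≤ s * (v ⬝ᵥ (P *ᵥ v))) : ‖S - P‖ ≤ s * ‖P‖ := by
  refine norm_le_of_form hSP (by positivity) fun v => (h v).trans ?_
  rw [mul_assoc]
  gcongr
  exact form_le_norm P v

theorem form_le_conditioned (hP : P.PosDef) (D : Matrix (Fin n) (Fin n) ℝ) (v : Fin n → ℝ) :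
    v ⬝ᵥ (D *ᵥ v) ≤ ‖P⁻¹‖ * ‖D‖ * (v ⬝ᵥ (P *ᵥ v)) := by
  have h := mul_le_mul_of_nonneg_left (form_le_norm_inv_mul_form hP v) (norm_nonneg D)
  linarith [form_le_norm D v]

/-- The step of the error recursion for policy evaluation with an approximately optimal gain. -/
theorem policyValue_step [NeZero n] (hQ : Q.PosDef) (hR : R.PosDef)
    (hP : IsRiccatiSolution A B Q R P) (hSP : (S - P).PosSemidef) (K : Matrix (Fin m) (Fin n) ℝ)
    {s μ τ : ℝ} (hs0 : 0 ≤ s) (hs : ∀ v, v ⬝ᵥ ((S - P) *ᵥ v) ≤ s * (v ⬝ᵥ (P *ᵥ v)))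
    (hμ : ‖R + Bᵀ * S * B‖ ≤ μ) (hK : ‖K - gain A B R S‖ ≤ τ) (v : Fin n → ℝ) :
    v ⬝ᵥ ((policyValue A B Q R S K - P) *ᵥ v) ≤
      (inducedNorm P (A - B * gain A B R P) ^ 2 * s + μ * τ ^ 2 / (2 * constA Q))
        * (v ⬝ᵥ (P *ᵥ v)) := by
  have ha := constA_pos hQ
  have h1 := form_policyValue_sub_le (A := A) (B := B) (Q := Q) hR hP hSP K v
  have h2 := hs ((A - B * gain A B R P) *ᵥ v)
  have h3 := mul_le_mul_of_nonneg_left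
    (form_mulVec_le_inducedNorm hP.1 (A - B * gain A B R P) v) hs0
  have h0 := dotProduct_self_nonneg' v
  have hμ0 : 0 ≤ μ := (norm_nonneg _).trans hμ
  have h4 : ‖R + Bᵀ * S * B‖ * ‖K - gain A B R S‖ ^ 2 * (v ⬝ᵥ v) ≤ μ * τ ^ 2 * (v ⬝ᵥ v) := by
    gcongr
  have h5 : μ * τ ^ 2 * (v ⬝ᵥ v) ≤ μ * τ ^ 2 / (2 * constA Q) * (v ⬝ᵥ (P *ᵥ v)) := by
    calc μ * τ ^ 2 * (v ⬝ᵥ v) = μ * τ ^ 2 / (2 * constA Q) * (2 * constA Q * (v ⬝ᵥ v)) := by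
          field_simp
      _ ≤ _ := by gcongr; exact hP.two_constA_le_form hQ hR v
  linarith

theorem rde_sub_posSemidef (hQ : Q.PosDef) (hR : R.PosDef)
    (hP : IsRiccatiSolution A B Q R P) (hQN : (QN - P).PosSemidef) (k : ℕ) :
    (rde A B Q R QN k - P).PosSemidef := by
  induction k with
  | zero => exact hQN
  | succ k ih => exact policyValue_sub_posSemidef hQ hR hP ih _

/-- Geometric convergence of the Riccati difference equation. -/
theorem form_rde_sub_le [NeZero n] (hQ : Q.PosDef) (hR : R.PosDef)
    (hP : IsRiccatiSolution A B Q R P) (hQN : (QN - P).PosSemidef) (k : ℕ) (v : Fin n → ℝ) :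
    v ⬝ᵥ ((rde A B Q R QN k - P) *ᵥ v) ≤
      (inducedNorm P (A - B * gain A B R P) ^ 2) ^ k * (‖P⁻¹‖ * ‖QN - P‖)
        * (v ⬝ᵥ (P *ᵥ v)) := by
  induction k generalizing v with
  | zero => simpa [rde] using form_le_conditioned hP.1 (QN - P) v
  | succ k ih =>
    -- The difference equation uses exact gains, so τ = 0 and only the contraction remains.
    have h := policyValue_step hQ hR hP (rde_sub_posSemidef hQ hR hP hQN k)
      (gain A B R (rde A B Q R QN k)) (τ := 0) (by positivity) ih le_rfl (by simp) v
    rw [rde_succ]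
    refine h.trans_eq ?_
    ring

/-- The horizon bound makes the truncation error of the gain at most `ε / 2`. -/
theorem truncation_error_le [NeZero n] [NeZero m] (hQ : Q.PosDef) (hR : R.PosDef)
    (hP : IsRiccatiSolution A B Q R P) (hQN : (QN - P).PosSemidef) {ε : ℝ} (hε : 0 < ε) {N : ℕ}
    (hN1 : 1 ≤ N) (hN : horizonBound A B R QN P ε ≤ N) :
    ‖B‖ * ‖A - B * gain A B R P‖ / lambdaMin R *
      ((inducedNorm P (A - B * gain A B R P) ^ 2) ^ (N - 1) * (‖P⁻¹‖ * ‖QN - P‖) * ‖P‖)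
        ≤ ε / 2 := by
  set AK := A - B * gain A B R P with hAK
  set ρ := inducedNorm P AK with hρ
  have hr := lambdaMin_pos hR
  set x := 2 * inducedNorm P (QN - P) * condNumber P * ‖AK‖ * ‖B‖ / (ε * lambdaMin R) with hx
  have hρ0 : 0 ≤ ρ := inducedNorm_nonneg _ _
  have hρ1 : ρ < 1 := hP.inducedNorm_lt_one hQ hR
  have hx0 : 0 ≤ x := by
    have := inducedNorm_nonneg P (QN - P)
    rw [hx]; unfold condNumber; positivity
  have hkey : x * (ρ ^ 2) ^ (N - 1) ≤ 1 := by
    rcases hx0.eq_or_lt with h0 | h0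
    · rw [← h0]; simp
    rcases hρ0.eq_or_lt with h1 | h1
    -- For ρ = 0 the real logarithm of 1/ρ is 0 and the horizon bound carries no information; but
    -- then the closed loop vanishes, contradicting x > 0.
    · exfalso
      have : ‖AK‖ ≤ 0 := by
        refine norm_le_of_mulVec le_rfl fun v => ?_
        have h2 := form_mulVec_le_inducedNorm hP.1 AK v
        rw [← hρ, ← h1] at h2
        have h3 : AK *ᵥ v = 0 := by
          by_contra hne
          have := form_pos hP.1 hne
          rw [zero_pow two_ne_zero, zero_mul] at h2
          linarith
        simp [h3]
      have h4 : ‖AK‖ = 0 := le_antisymm this (norm_nonneg _)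
      rw [hx, h4] at h0
      simp at h0
    · exact mul_pow_le_one_of_log hN1 h0 h1 hρ1 hN
  have hD := norm_le_inducedNorm hP.1 hQN
  rw [hx, condNumber] at hkey
  have ht : 0 ≤ (ρ ^ 2) ^ (N - 1) := pow_nonneg (pow_nonneg hρ0 2) _
  exact half_bound_of_scaled (norm_nonneg B) (norm_nonneg AK) hr (norm_nonneg P⁻¹) (norm_nonneg P)
    ht hε hD hkey

end

end LQR

/-! ### Tolerances and accumulated policy errors. -/

namespace LQR

noncomputable section

variable {n m : ℕ} {A : Matrix (Fin n) (Fin n) ℝ} {B : Matrix (Fin n) (Fin m) ℝ}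
  {Q : Matrix (Fin n) (Fin n) ℝ} {R : Matrix (Fin m) (Fin m) ℝ}
  {S P QN : Matrix (Fin n) (Fin n) ℝ}

theorem mul_sq_le_of_le_sqrt {c t u : ℝ} (hc : 0 < c) (ht0 : 0 ≤ t) (hu : 0 ≤ u)
    (ht : t ≤ Real.sqrt u) : c * t ^ 2 ≤ c * u := by
  have : t ^ 2 ≤ u := (Real.le_sqrt ht0 hu).1 ht
  gcongr

theorem tolerance_nonneg {N : ℕ} {ε : ℝ} (hε : 0 < ε) (h : ℕ) :
    0 ≤ tolerance A B Q R QN N ε h := by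
  unfold tolerance
  dsimp only
  split_ifs
  · positivity
  · exact le_min (Real.sqrt_nonneg _) (Real.sqrt_nonneg _)
  · exact le_min (le_min (Real.sqrt_nonneg _) (Real.sqrt_nonneg _))
      (le_min (Real.sqrt_nonneg _) (Real.sqrt_nonneg _))

theorem tolerance_eq_one {N : ℕ} {ε : ℝ} {h : ℕ} (hh : h ≠ 0) :
    tolerance A B Q R QN N ε h = tolerance A B Q R QN N ε 1 := by
  simp only [tolerance, if_neg hh, if_neg one_ne_zero]

theorem tolerance_one_le {N : ℕ} {ε : ℝ} :
    tolerance A B Q R QN N ε 1 ≤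
      Real.sqrt (constA Q / constC3 B Q R QN * (constA Q / (2 * Real.exp 1 * N * ‖QN‖))) := by
  unfold tolerance
  dsimp only
  rw [if_neg one_ne_zero]
  split_ifs
  · exact min_le_right _ _
  · exact (min_le_left _ _).trans (min_le_right _ _)

theorem tolerance_one_le_of_constC1_ne_zero {N : ℕ} {ε : ℝ} (h : constC1 A B Q R QN N ≠ 0) :
    tolerance A B Q R QN N ε 1 ≤ Real.sqrt (constA Q / constC3 B Q R QN *
      (ε / (8 * Real.exp 1 * N * constC1 A B Q R QN N * ‖QN‖))) := by
  unfold tolerance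
  dsimp only
  rw [if_neg one_ne_zero, if_neg h]
  exact (min_le_right _ _).trans (min_le_left _ _)

theorem norm_closedLoop_le_constPhi {N : ℕ} (hN : 1 ≤ N) :
    ‖A - B * gain A B R (rde A B Q R QN (N - 1))‖ ≤ constPhi A B Q R QN N :=
  le_ciSup (f := fun t : Fin N => ‖A - B * rdeK A B Q R QN N t‖) (Set.finite_range _).bddAbove
    ⟨0, hN⟩

theorem norm_inputWeight_le [NeZero n] (hQ : Q.PosDef) (hR : R.PosDef) (hS : S.PosSemidef)
    (hSQN : ∀ v, v ⬝ᵥ (S *ᵥ v) ≤ v ⬝ᵥ (QN *ᵥ v)) :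
    ‖R + Bᵀ * S * B‖ ≤ constC3 B Q R QN / 2 := by
  rw [constC3, mul_div_cancel_left₀ _ two_ne_zero]
  refine norm_mono (inputWeight_posDef hR hS).posSemidef fun v => ?_
  simp only [Matrix.add_mulVec _ _ v, dotProduct_add, form_mulVec]
  rw [Matrix.add_mulVec, dotProduct_add, Matrix.smul_mulVec, Matrix.one_mulVec, dotProduct_smul,
    smul_eq_mul]
  have := hSQN (B *ᵥ v)
  have := mul_nonneg (constA_pos hQ).le (dotProduct_self_nonneg' (B *ᵥ v))
  linarith

/-- S ⪯ (1 + s)P and R ⪯ (1 + s)R give M_S ⪯ (1 + s)M_P. This growth in s is what produces the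
factor 1 + s in the recursion. -/
theorem norm_inputWeight_le_of_form [NeZero n] (hQ : Q.PosDef) (hR : R.PosDef)
    (hP : P.PosSemidef) (hS : S.PosSemidef) (hPQN : ∀ v, v ⬝ᵥ (P *ᵥ v) ≤ v ⬝ᵥ (QN *ᵥ v)) {s : ℝ}
    (hs0 : 0 ≤ s) (hs : ∀ v, v ⬝ᵥ ((S - P) *ᵥ v) ≤ s * (v ⬝ᵥ (P *ᵥ v))) :
    ‖R + Bᵀ * S * B‖ ≤ constC3 B Q R QN / 2 * (1 + s) := by
  have h1 := norm_inputWeight_le (B := B) hQ hR hP hPQN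
  have h0 : 0 ≤ constC3 B Q R QN / 2 := (norm_nonneg _).trans h1
  refine norm_le_of_form (inputWeight_posDef hR hS).posSemidef (by positivity) fun v => ?_
  have h2 := (form_le_norm (R + Bᵀ * P * B) v).trans
    (mul_le_mul_of_nonneg_right h1 (dotProduct_self_nonneg' v))
  have h3 := mul_le_mul_of_nonneg_right h2 (show 0 ≤ 1 + s by positivity)
  have h4 := hs (B *ᵥ v)
  have h5 := mul_nonneg hs0 (form_nonneg hR.posSemidef v)
  rw [Matrix.add_mulVec, dotProduct_add, form_mulVec] at h3 ⊢
  rw [Matrix.sub_mulVec, dotProduct_sub] at h4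
  linarith

/-- The tolerances are small enough for the accumulated policy errors to cost at most a fixed
fraction of `ε`, even though the tolerance involves the closed loops of the difference equation
rather than the closed loop of the algebraic Riccati equation. -/
theorem closedLoop_mul_tolerance_le [NeZero n] [NeZero m] (hQ : Q.PosDef) (hR : R.PosDef)
    (hP : IsRiccatiSolution A B Q R P) (hQN : (QN - P).PosSemidef) {ε : ℝ} (hε : 0 < ε) {N : ℕ}
    (hN1 : 1 ≤ N) (hN : horizonBound A B R QN P ε ≤ N) (hC3 : 0 < constC3 B Q R QN)
    (hq : 0 < ‖QN‖) :
    ‖B‖ * ‖A - B * gain A B R P‖ / lambdaMin R *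
      (constC3 B Q R QN * tolerance A B Q R QN N ε 1 ^ 2) ≤
        constA Q * (ε / (4 * Real.exp 1 * N * ‖QN‖)) := by
  have ha := constA_pos hQ
  have hr := lambdaMin_pos hR
  have hN' : (0 : ℝ) < N := by exact_mod_cast hN1
  have ht0 := tolerance_nonneg (A := A) (B := B) (Q := Q) (R := R) (QN := QN) (N := N) hε 1
  set c := ‖B‖ * ‖A - B * gain A B R P‖ / lambdaMin R with hc
  have hc0 : 0 ≤ c := by positivity
  set P₁ := rde A B Q R QN (N - 1) with hP₁
  have hP₁P : (P₁ - P).PosSemidef := rde_sub_posSemidef hQ hR hP hQN _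
  have hP₁0 : P₁.PosSemidef := by simpa using hP₁P.add hP.1.posSemidef
  have hφ : ‖A - B * gain A B R P₁‖ ≤ constPhi A B Q R QN N := norm_closedLoop_le_constPhi hN1
  rcases le_total ‖A - B * gain A B R P‖ (2 * constPhi A B Q R QN N) with h | h
  · have hcC : c ≤ 2 * constC1 A B Q R QN N := by
      calc c ≤ ‖B‖ * (2 * constPhi A B Q R QN N) / lambdaMin R := by rw [hc]; gcongr
        _ = _ := by unfold constC1; ring
    have hC0 : 0 ≤ constC1 A B Q R QN N := by linarith
    -- If C₁ = 0 the third tolerance term is absent, but then c = 0 as well.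
    rcases hC0.eq_or_lt with h0 | h0
    · have : c = 0 := by linarith
      rw [this, zero_mul]; positivity
    · have h1 := mul_sq_le_of_le_sqrt hC3 ht0 (by positivity)
        (tolerance_one_le_of_constC1_ne_zero h0.ne')
      calc _ ≤ (2 * constC1 A B Q R QN N) * (constC3 B Q R QN * (constA Q / constC3 B Q R QN *
            (ε / (8 * Real.exp 1 * N * constC1 A B Q R QN N * ‖QN‖)))) := by gcongr
        _ = _ := by field_simp; ring
  · have h1 := mul_sq_le_of_le_sqrt hC3 ht0 (by positivity) tolerance_one_le
    have hca : c * constA Q ≤ ε / 2 := by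
      rcases (norm_nonneg (A - B * gain A B R P)).eq_or_lt with h0 | h0
      · rw [hc, ← h0, mul_zero, zero_div, zero_mul]; positivity
      have h2 := norm_closedLoop_le (A := A) (B := B) hR hP₁0 hP.1.posSemidef
        (c := 2 * constA Q) (by positivity) fun v => by
          have h3 := form_nonneg hP₁P v
          rw [Matrix.sub_mulVec, dotProduct_sub] at h3
          linarith [hP.two_constA_le_form hQ hR v]
      -- With φ ≤ ‖A - B g_P‖/2, the closed-loop comparison leaves 1/2 ≤ ‖P₁ - P‖/(2a).
      have h3 : constA Q ≤ ‖P₁ - P‖ := by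
        have h4 : ‖A - B * gain A B R P‖ * constA Q ≤ ‖A - B * gain A B R P‖ * ‖P₁ - P‖ := by
          have h5 : 1 / (2 * constA Q) * ‖P₁ - P‖ * ‖A - B * gain A B R P‖ * (2 * constA Q) =
              ‖P₁ - P‖ * ‖A - B * gain A B R P‖ := by field_simp
          have h6 := mul_le_mul_of_nonneg_right
            (show ‖A - B * gain A B R P‖ / 2 ≤
              1 / (2 * constA Q) * ‖P₁ - P‖ * ‖A - B * gain A B R P‖ by linarith)
            (show 0 ≤ 2 * constA Q by positivity)
          linarith
        exact le_of_mul_le_mul_left h4 h0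
      have h7 := norm_sub_le_of_form hP₁P
        (mul_nonneg (pow_nonneg (sq_nonneg _) _) (by positivity))
        (form_rde_sub_le hQ hR hP hQN (N - 1))
      exact (mul_le_mul_of_nonneg_left (h3.trans h7) hc0).trans
        (truncation_error_le hQ hR hP hQN hε hN1 hN)
    calc _ ≤ c * (constC3 B Q R QN * (constA Q / constC3 B Q R QN *
          (constA Q / (2 * Real.exp 1 * N * ‖QN‖)))) := by gcongr
      _ = c * constA Q * (constA Q / (2 * Real.exp 1 * N * ‖QN‖)) := by field_simp
      _ ≤ ε / 2 * (constA Q / (2 * Real.exp 1 * N * ‖QN‖)) := by gcongr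
      _ = _ := by field_simp; ring

/-- The cost matrix of the approximate policies one step after the initial time, compared with the
solution of the algebraic Riccati equation. -/
theorem form_costToGo_sub_le [NeZero n] [NeZero m] (hQ : Q.PosDef) (hR : R.PosDef)
    (hP : IsRiccatiSolution A B Q R P) (hQN : (QN - P).PosSemidef) {ε : ℝ} (hε : 0 < ε) {N : ℕ}
    (hN1 : 1 ≤ N) (hC3 : 0 < constC3 B Q R QN) {Kt : ℕ → Matrix (Fin m) (Fin n) ℝ}
    (hKt : ∀ k, k + 1 < N →
      ‖Kt (N - 1 - k) - gain A B R (costToGo A B Q R QN N Kt k)‖ ≤ tolerance A B Q R QN N ε 1)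
    {ν : ℝ} (hν : ν = constC3 B Q R QN * tolerance A B Q R QN N ε 1 ^ 2 / (4 * constA Q))
    (v : Fin n → ℝ) :
    v ⬝ᵥ ((costToGo A B Q R QN N Kt (N - 1) - P) *ᵥ v) ≤
      (5 / 4 * ((inducedNorm P (A - B * gain A B R P) ^ 2) ^ (N - 1) * (‖P⁻¹‖ * ‖QN - P‖))
        + 2 * N * ν) * (v ⬝ᵥ (P *ᵥ v)) := by
  have ha := constA_pos hQ
  have hN' : (0 : ℝ) < N := by exact_mod_cast hN1
  have ht0 := tolerance_nonneg (A := A) (B := B) (Q := Q) (R := R) (QN := QN) (N := N) hε 1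
  have hPform := hP.two_constA_le_form hQ hR
  have hPQN : ∀ v, v ⬝ᵥ (P *ᵥ v) ≤ v ⬝ᵥ (QN *ᵥ v) := fun v => by
    have := form_nonneg hQN v
    rw [Matrix.sub_mulVec, dotProduct_sub] at this
    linarith
  have hq : 2 * constA Q ≤ ‖QN‖ := le_norm_of_form fun v => (hPform v).trans (hPQN v)
  have hq0 : 0 < ‖QN‖ := by linarith
  have hQNP : QN.PosSemidef := by simpa using hQN.add hP.1.posSemidef
  have hD : ‖QN - P‖ ≤ ‖QN‖ := norm_mono hQN fun v => by
    rw [Matrix.sub_mulVec, dotProduct_sub]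
    linarith [form_nonneg hP.1.posSemidef v]
  have hSP := costToGo_sub_posSemidef hQ hR hP hQN N Kt
  have hinv := norm_inv_le hP.1 (c := 2 * constA Q) (by positivity) hPform
  refine perturbed_recursion_bound (b := fun k s => ∀ v, v ⬝ᵥ
    ((costToGo A B Q R QN N Kt k - P) *ᵥ v) ≤ s * (v ⬝ᵥ (P *ᵥ v))) (a := constA Q) (q := ‖QN‖)
    hN1 ?_ ?_ ?_ ?_ (inducedNorm_nonneg _ _) (hP.inducedNorm_lt_one hQ hR).le (by positivity)
    (by rw [hν]; positivity) ha hq ?_ ?_ v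
  · intro k s t hs hst v
    exact (hs v).trans (mul_le_mul_of_nonneg_right hst (form_nonneg hP.1.posSemidef v))
  · exact form_le_conditioned hP.1 (QN - P)
  -- At the last stage S = QN, whose input weight is bounded by C₃/2 directly, without the factor 1
  -- + δ.
  · intro h1 v
    have h := policyValue_step (A := A) (B := B) hQ hR hP hQN (Kt (N - 1 - 0)) (by positivity)
      (form_le_conditioned hP.1 (QN - P))
      (norm_inputWeight_le hQ hR hQNP fun v => le_rfl) (hKt 0 (by omega)) v
    refine h.trans_eq ?_
    rw [hν]
    congr 2
    ring
  · intro k s hk hs0 hs v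
    have h := policyValue_step (A := A) (B := B) hQ hR hP (hSP k) (Kt (N - 1 - k)) hs0 hs
      (norm_inputWeight_le_of_form hQ hR hP.1.posSemidef
        (by simpa using (hSP k).add hP.1.posSemidef) hPQN hs0 hs) (hKt k hk) v
    refine h.trans_eq ?_
    rw [hν]
    congr 2
    ring
  · calc ‖P⁻¹‖ * ‖QN - P‖ * (2 * constA Q) ≤ 1 / (2 * constA Q) * ‖QN‖ * (2 * constA Q) := by
          gcongr
      _ = ‖QN‖ := by field_simp
  -- The second tolerance term is exactly the smallness of ν that the recursion requires.
  · have h1 := mul_sq_le_of_le_sqrt hC3 ht0 (by positivity) (tolerance_one_le (A := A))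
    calc 8 * Real.exp 1 * N * ‖QN‖ * ν
        = 2 * Real.exp 1 * N * ‖QN‖ / constA Q *
          (constC3 B Q R QN * tolerance A B Q R QN N ε 1 ^ 2) := by rw [hν]; field_simp; ring
      _ ≤ 2 * Real.exp 1 * N * ‖QN‖ / constA Q * (constC3 B Q R QN *
          (constA Q / constC3 B Q R QN * (constA Q / (2 * Real.exp 1 * N * ‖QN‖)))) := by gcongr
      _ = constA Q := by field_simp

/-- The budget is 3/4 = (5/4)(1/2) + 1/8: amplified truncation error plus accumulated policy error.
-/
theorem gain_error_le [NeZero n] [NeZero m] (hQ : Q.PosDef) (hR : R.PosDef)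
    (hP : IsRiccatiSolution A B Q R P) (hQN : (QN - P).PosSemidef) {ε : ℝ} (hε : 0 < ε) {N : ℕ}
    (hN1 : 1 ≤ N) (hN : horizonBound A B R QN P ε ≤ N) {Kt : ℕ → Matrix (Fin m) (Fin n) ℝ}
    (hKt : ∀ k, k + 1 < N →
      ‖Kt (N - 1 - k) - gain A B R (costToGo A B Q R QN N Kt k)‖ ≤ tolerance A B Q R QN N ε 1) :
    ‖gain A B R (costToGo A B Q R QN N Kt (N - 1)) - gain A B R P‖ ≤ 3 / 4 * ε := by
  have he := Real.exp_one_gt_d9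
  have ha := constA_pos hQ
  have hr := lambdaMin_pos hR
  have hN' : (0 : ℝ) < N := by exact_mod_cast hN1
  have hPQN : ∀ v, v ⬝ᵥ (P *ᵥ v) ≤ v ⬝ᵥ (QN *ᵥ v) := fun v => by
    have := form_nonneg hQN v
    rw [Matrix.sub_mulVec, dotProduct_sub] at this
    linarith
  have hPQ : ‖P‖ ≤ ‖QN‖ := norm_mono hP.1.posSemidef hPQN
  have hq0 : 0 < ‖QN‖ := by
    have := le_norm_of_form (hP.two_constA_le_form hQ hR)
    linarith
  have hC3 : 0 < constC3 B Q R QN := by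
    have h1 : lambdaMin R ≤ ‖R + Bᵀ * P * B‖ := le_norm_of_form fun v => by
      rw [Matrix.add_mulVec, dotProduct_add]
      linarith [lambdaMin_mul_le_form hR.posSemidef v,
        form_nonneg (conj_posSemidef hP.1.posSemidef B) v]
    linarith [norm_inputWeight_le (B := B) hQ hR hP.1.posSemidef hPQN]
  have ht0 := tolerance_nonneg (A := A) (B := B) (Q := Q) (R := R) (QN := QN) (N := N) hε 1
  have hform := form_costToGo_sub_le hQ hR hP hQN hε hN1 hC3 hKt rfl
  have htrunc := truncation_error_le hQ hR hP hQN hε hN1 hN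
  have htol := closedLoop_mul_tolerance_le hQ hR hP hQN hε hN1 hN hC3 hq0
  have hSP := costToGo_sub_posSemidef hQ hR hP hQN N Kt (N - 1)
  set c := ‖B‖ * ‖A - B * gain A B R P‖ / lambdaMin R with hc
  have hc0 : 0 ≤ c := by positivity
  set g := (inducedNorm P (A - B * gain A B R P) ^ 2) ^ (N - 1) * (‖P⁻¹‖ * ‖QN - P‖) with hg
  have hg0 : 0 ≤ g := mul_nonneg (pow_nonneg (sq_nonneg _) _) (by positivity)
  set w := constC3 B Q R QN * tolerance A B Q R QN N ε 1 ^ 2 with hw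
  have hw0 : 0 ≤ w := by positivity
  have hnorm := norm_sub_le_of_form hSP (by positivity) hform
  have hgain := norm_gain_sub_gain_le (A := A) (B := B) hR
    (by simpa using hSP.add hP.1.posSemidef) hP.1.posSemidef hr
    (lambdaMin_mul_le_form hR.posSemidef)
  refine hgain.trans ((mul_le_mul_of_nonneg_left hnorm hc0).trans ?_)
  have hsecond : N / (2 * constA Q) * ‖P‖ * (c * w) ≤ ε / 8 := by
    calc N / (2 * constA Q) * ‖P‖ * (c * w)
        ≤ N / (2 * constA Q) * ‖QN‖ * (constA Q * (ε / (4 * Real.exp 1 * N * ‖QN‖))) := by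
          gcongr
      _ = ε / (8 * Real.exp 1) := by field_simp; norm_num
      _ ≤ ε / 8 := by gcongr; linarith
  have hsplit : c * ((5 / 4 * g + 2 * N * (w / (4 * constA Q))) * ‖P‖) =
      5 / 4 * (c * (g * ‖P‖)) + N / (2 * constA Q) * ‖P‖ * (c * w) := by
    field_simp
    ring
  rw [hsplit]
  linarith

end

end LQR

/-! ### Conclusion: the gain estimate and stability. -/

theorem mainTheorem1 {n m : ℕ} [NeZero n] [NeZero m]
    -- the system and the cost
    (A : Matrix (Fin n) (Fin n) ℝ) (B : Matrix (Fin n) (Fin m) ℝ)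
    (Q : Matrix (Fin n) (Fin n) ℝ) (R : Matrix (Fin m) (Fin m) ℝ)
    (hQ : Q.PosDef) (hR : R.PosDef) (hAB : LQR.IsStabilizable A B) (hA : IsUnit A)
    -- the law of the initial state
    (D : MeasureTheory.Measure (Fin n → ℝ)) (S₀ : Matrix (Fin n) (Fin n) ℝ) (Cm : ℝ)
    (hS₀ : S₀.PosDef) (hCm : 0 < Cm) (hD : LQR.IsInitialLaw D S₀ Cm)
    -- the solution of the algebraic Riccati equation, and the terminal cost
    (P QN : Matrix (Fin n) (Fin n) ℝ)
    (hP : LQR.IsRiccatiSolution A B Q R P) (hQN : (QN - P).PosSemidef)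
    -- the accuracy and the horizon
    (ε : ℝ) (hε : 0 < ε) (N : ℕ) (hN1 : 1 ≤ N) (hN : LQR.horizonBound A B R QN P ε ≤ N)
    -- the stage policies, and the minimizers of the surrogate costs that they define
    (Kt Ktopt : ℕ → Matrix (Fin m) (Fin n) ℝ)
    (hopt : ∀ h < N, IsMinOn (LQR.surrogateCost A B Q R QN D N Kt h) Set.univ (Ktopt h))
    (hKt : ∀ h < N, ‖Kt h - Ktopt h‖ ≤ LQR.tolerance A B Q R QN N ε h) :
    ‖Kt 0 - LQR.gain A B R P‖ ≤ ε ∧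
      (ε * (Real.sqrt (LQR.condNumber P) * ‖B‖)
          < 1 - LQR.inducedNorm P (A - B * LQR.gain A B R P) →
        LQR.IsStabilizing A B (Kt 0)) := by
  have hgain : ∀ h < N,
      Ktopt h = LQR.gain A B R (LQR.costToGo A B Q R QN N Kt (N - 1 - h)) := fun h hh =>
    LQR.eq_gain_of_isMinOn hR hD hS₀ hh (by
      simpa using (LQR.costToGo_sub_posSemidef hQ hR hP hQN N Kt _).add hP.1.posSemidef)
      (hopt h hh)
  have hstage : ∀ k, k + 1 < N →
      ‖Kt (N - 1 - k) - LQR.gain A B R (LQR.costToGo A B Q R QN N Kt k)‖ ≤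
        LQR.tolerance A B Q R QN N ε 1 := fun k hk => by
    -- Since k + 1 < N, the stage N - 1 - k is nonzero, and all such stages share one tolerance.
    have h := hKt (N - 1 - k) (by omega)
    rwa [hgain _ (by omega), Nat.sub_sub_self (by omega),
      LQR.tolerance_eq_one (by omega)] at h
  have hmain : ‖Kt 0 - LQR.gain A B R P‖ ≤ ε := by
    have h0 := hKt 0 hN1
    rw [hgain 0 hN1, Nat.sub_zero, LQR.tolerance, if_pos rfl] at h0
    have h1 := LQR.gain_error_le hQ hR hP hQN hε hN1 hN hstage
    have h2 := norm_sub_le_norm_sub_add_norm_sub (Kt 0)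
      (LQR.gain A B R (LQR.costToGo A B Q R QN N Kt (N - 1))) (LQR.gain A B R P)
    linarith
  refine ⟨hmain, fun h => ?_⟩
  -- The actual closed loop is the optimal one perturbed by a matrix of norm at most ‖B‖ε.
  have hsum : A - B * Kt 0 =
      (A - B * LQR.gain A B R P) + -(B * (Kt 0 - LQR.gain A B R P)) := by
    rw [Matrix.mul_sub]; abel
  rw [LQR.IsStabilizing, hsum]
  refine LQR.isStable_add hP.1 ?_
  rw [norm_neg]
  have h1 : ‖B * (Kt 0 - LQR.gain A B R P)‖ ≤ ‖B‖ * ε :=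
    (Matrix.l2_opNorm_mul _ _).trans (mul_le_mul_of_nonneg_left hmain (norm_nonneg _))
  have h2 := mul_le_mul_of_nonneg_left h1 (Real.sqrt_nonneg (LQR.condNumber P))
  linarith
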